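/- Let $i,j>0$ with $i+j=1$, and let $\theta\in\mathbb R$ and $c(\theta)>0$ satisfy $q^{1/i}|q\theta-p|>c(\theta)$ for all $p\in\mathbb Z$ and all integers $q\ge 1$. Let $\Theta=\{(\theta,y):y\in[0,1]\}$, identified with $[0,1]$ through $y$, and let $\mu$ be a Borel probability measure on $\Theta$ satisfying a power law: there are $\beta,b_1,b_2>0$ with $b_1r^\beta\le\mu(B(x,r))\le b_2r^\beta$ for all $x\in\operatorname{supp}\mu$ and $0<r<1$, where $B(x,r)$ is the closed ball. Put $$\alpha=\frac{\beta ij}{4},\qquad \varepsilon=\frac{\alpha\beta^2ij}{20},\qquad c_5=4^{\frac{2}{ij}+2}\,\frac{b_2}{b_1},$$ let $R_0$ be the largest solution $x>1$ of $x^{\varepsilon}=\log_2x$, and put $$R_1=\max\Big\{R_0,\ \Big(\tfrac{64b_2^2}{b_1^2}\Big)^{\frac{10}{\alpha\beta^2ij}},\ c_5^{\frac{2}{\alpha\beta}}\Big\},\qquad R_2=2^{2/\beta}.$$ Let $R\ge\max\{R_1,R_2\}$ be an integer and put $c_1=\min\{c(\theta)R^{1+\alpha},\tfrac14R^{-3i/j}\}$,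 $c=c_1R^{-1-\alpha}$. For $\gamma\ge 0$ and an interval $I=B(y,r)$ write $\gamma I=B(y,\gamma r)$. For a collection $\mathcal F$ of intervals, a *covering selection* from $\mathcal F$ is a subcollection $\mathcal G\subseteq\mathcal F$ of pairwise disjoint intervals with $\bigcup_{I\in\mathcal F}I\subseteq\bigcup_{I\in\mathcal G}5I$. Let $\mathcal I_0$ be any covering selection from $\{B(y,\tfrac12c_1):y\in\operatorname{supp}\mu\}$. Recursively, for $n\ge0$ and each $I'\in\mathcal I_n$, let $\mathcal I_{n+1}(I')$ be any covering selection from $\{B(y,\tfrac12c_1R^{-n-1}):y\in\operatorname{supp}\mu\cap(1-R^{-\alpha})I'\}$, and let $\mathcal I_{n+1}=\bigcup_{I'\in\mathcal I_n}\mathcal I_{n+1}(I')$. For integers $A,B,C$ with $B>0$ and $\gcd(A,B,C)=1$ let $L=L(A,B,C)$ be the line $Ax-By+C=0$, let $H(A,B)=B\max\{|A|^{1/i},|B|^{1/j}\}$, and let $$\Delta(L)=\Big\{y\in[0,1]:|A\theta-By+C|\le\frac{c}{\max\{|A|^{1/i},|B|^{1/j}\}}\Big\}.$$ Let $C(n)$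 be the set of such lines with $R^{n-1}\le H(A,B)<R^n$. Put $\mathcal J_0=\mathcal I_0$ and, for $n\ge 0$, $$\mathcal J_{n+1}=\Big\{I\in\bigcup_{J\in\mathcal J_n}\mathcal I_{n+1}(J):\ \Delta(L)\cap I=\varnothing\ \text{for all }L\in C(n)\Big\}.$$ A *tree-like family* with root $J_0$ is a sequence $(\mathcal T_n)_{n\ge0}$ of collections of closed intervals of positive length such that $\mathcal T_0=\{J_0\}$; for $n\ge1$, any two distinct members of $\mathcal T_n$ have at most one common point and each member of $\mathcal T_n$ is contained in a member of $\mathcal T_{n-1}$; and, for $n\ge1$, each $J\in\mathcal T_{n-1}$ contains at least one member of $\mathcal T_n$. It is *$r$-regular* if for every $n\ge1$ each $J\in\mathcal T_{n-1}$ contains exactly $r$ members of $\mathcal T_n$. **Lemma.** Let $J_0\in\mathcal J_0$ and let $(\mathcal T_n)_{n\ge0}$ be a $\lceil 3R^{\beta-\varepsilon}\rceil$-regular tree-like family with root $J_0$ such that $\mathcal T_n\subseteq\mathcal I_n$ for every $n$. Then $\mathcal T_n\cap\mathcal J_n\ne\varnothing$ for every $n\ge0$. -/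

import Mathlib

open MeasureTheory Set

noncomputable section

namespace VerticalCantor

/-- `μ` satisfies a power law with exponent `β` and constants `b₁`, `b₂`. -/
structure PowerLaw {X : Type*} [PseudoMetricSpace X] [MeasurableSpace X]
    (μ : Measure X) (β b₁ b₂ : ℝ) : Prop where
  exponent_pos : 0 < β
  lower_pos : 0 < b₁
  upper_pos : 0 < b₂
  lower : ∀ x ∈ μ.support, ∀ r : ℝ, 0 < r → r < 1 →
    ENNReal.ofReal (b₁ * r ^ β) ≤ μ (Metric.closedBall x r)
  upper : ∀ x ∈ μ.support, ∀ r : ℝ, 0 < r → r < 1 →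
    μ (Metric.closedBall x r) ≤ ENNReal.ofReal (b₂ * r ^ β)

/-- `cθ` is a constant witnessing that `θ` is badly approximable with weight `i`. -/
def BadWitness (i θ cθ : ℝ) : Prop :=
  0 < cθ ∧ ∀ (p : ℤ) (q : ℕ), 0 < q → cθ < (q : ℝ) ^ (1 / i) * |(q : ℝ) * θ - p|

/-! ### Numerical parameters -/

/-- The exponent `α = β i j / 4`. -/
def expAlpha (β i j : ℝ) : ℝ := β * i * j / 4

/-- The exponent `ε = α β² i j / 20`. -/
def expEps (β i j : ℝ) : ℝ := expAlpha β i j * β ^ 2 * i * j / 20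

/-- The constant `c₁ = min {c(θ) R^(1+α), R^(-3i/j) / 4}`. -/
def const1 (β i j cθ R : ℝ) : ℝ :=
  min (cθ * R ^ (1 + expAlpha β i j)) (1 / 4 * R ^ (-(3 * i / j)))

/-- The constant `c = c₁ / R^(1+α)`. -/
def const0 (β i j cθ R : ℝ) : ℝ := const1 β i j cθ R / R ^ (1 + expAlpha β i j)

/-- The constant `c₅ = 4^(2/(ij)+2) b₂ / b₁`. -/
def const5 (i j b₁ b₂ : ℝ) : ℝ := (4 : ℝ) ^ (2 / (i * j) + 2) * (b₂ / b₁)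

/-- The largest solution `x > 1` of `x ^ ε = log₂ x`. -/
def threshold0 (β i j : ℝ) : ℝ :=
  sSup {x : ℝ | 1 < x ∧ x ^ expEps β i j = Real.logb 2 x}

/-- The threshold `R₁`. -/
def threshold1 (β i j b₁ b₂ : ℝ) : ℝ :=
  max (threshold0 β i j)
    (max ((64 * b₂ ^ 2 / b₁ ^ 2) ^ (10 / (expAlpha β i j * β ^ 2 * i * j)))
      (const5 i j b₁ b₂ ^ (2 / (expAlpha β i j * β))))

/-- The threshold `R₂ = 2^(2/β)`. -/
def threshold2 (β : ℝ) : ℝ := (2 : ℝ) ^ (2 / β)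

/-! ### Lines and the dangerous intervals -/

/-- The quantity `max {|A|^(1/i), |B|^(1/j)}`. -/
def weight (i j : ℝ) (A B : ℤ) : ℝ := max (|(A : ℝ)| ^ (1 / i)) (|(B : ℝ)| ^ (1 / j))

/-- The height `H(A,B) = B max {|A|^(1/i), |B|^(1/j)}`. -/
def height (i j : ℝ) (A B : ℤ) : ℝ := (B : ℝ) * weight i j A B

/-- The line `A x - B y + C = 0` is in normal form (`gcd(A,B,C) = 1` and `B > 0`) and belongs
to the class `C(n)`, that is, `R^(n-1) ≤ H(A,B) < R^n`. -/
def LineClass (i j R : ℝ) (n : ℕ) (A B C : ℤ) : Prop :=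
  Int.gcd A (Int.gcd B C) = 1 ∧ 0 < B ∧
    R ^ ((n : ℤ) - 1) ≤ height i j A B ∧ height i j A B < R ^ n

/-- The set `Δ(L)` for `L = L(A,B,C)`, as a set of ordinates `y ∈ [0,1]` of points `(θ,y)`. -/
def danger (i j θ c : ℝ) (A B C : ℤ) : Set ℝ :=
  {y | y ∈ Icc (0 : ℝ) 1 ∧ |(A : ℝ) * θ - B * y + C| ≤ c / weight i j A B}

/-! ### The construction of the interval families -/

/-- For a bounded closed interval `I = B(y,r)`, the interval `γ I = B(y, γ r)`. -/
def dilate (γ : ℝ) (I : Set ℝ) : Set ℝ :=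
  Metric.closedBall ((sInf I + sSup I) / 2) (γ * ((sSup I - sInf I) / 2))

theorem dilate_closedBall (γ y r : ℝ) (hr : 0 ≤ r) :
    dilate γ (Metric.closedBall y r) = Metric.closedBall y (γ * r) := by
  have h : y - r ≤ y + r := by linarith
  have hI : sInf (Metric.closedBall y r) = y - r := by rw [Real.closedBall_eq_Icc, csInf_Icc h]
  have hS : sSup (Metric.closedBall y r) = y + r := by rw [Real.closedBall_eq_Icc, csSup_Icc h]
  rw [dilate, hI, hS]
  congr 1 <;> ring

/-- `𝓖` is a possible outcome of the `5r`-covering lemma applied to `𝓕`. -/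
structure IsCoveringSelection (𝓕 𝓖 : Set (Set ℝ)) : Prop where
  subset : 𝓖 ⊆ 𝓕
  disjoint : ∀ I₁ ∈ 𝓖, ∀ I₂ ∈ 𝓖, I₁ ≠ I₂ → Disjoint I₁ I₂
  cover : ⋃₀ 𝓕 ⊆ ⋃ I ∈ 𝓖, dilate 5 I

/-- All closed intervals of radius `r` whose centre lies in `S`. -/
def centred (S : Set ℝ) (r : ℝ) : Set (Set ℝ) := {I | ∃ y ∈ S, I = Metric.closedBall y r}

/-- The radius `c₁ R^(-n) / 2` of the intervals of level `n`. -/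
def levelRadius (c₁ R : ℝ) (n : ℕ) : ℝ := 1 / 2 * c₁ * R ^ (-(n : ℤ))

/-- The families `ℐ_n`: `𝓢₀` is the chosen level `0`, and `sel n I'` is the collection
`ℐ_{n+1}(I')` chosen inside `I' ∈ ℐ_n`. -/
def familyI (𝓢₀ : Set (Set ℝ)) (sel : ℕ → Set ℝ → Set (Set ℝ)) : ℕ → Set (Set ℝ)
  | 0 => 𝓢₀
  | n + 1 => ⋃ I' ∈ familyI 𝓢₀ sel n, sel n I'

/-- The choices made in the construction: level `0` is selected by the `5r`-covering lemma from
the intervals of radius `c₁/2` centred in `supp μ`; for `I' ∈ ℐ_n`, the collection `ℐ_{n+1}(I')`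
is selected from the intervals of radius `c₁ R^(-n-1) / 2` centred in `supp μ ∩ (1 - R^(-α)) I'`. -/
structure IsChoice (μ : Measure ℝ) (α c₁ R : ℝ) (𝓢₀ : Set (Set ℝ))
    (sel : ℕ → Set ℝ → Set (Set ℝ)) : Prop where
  zero : IsCoveringSelection (centred μ.support (levelRadius c₁ R 0)) 𝓢₀
  succ : ∀ n, ∀ I' ∈ familyI 𝓢₀ sel n,
    IsCoveringSelection
      (centred (μ.support ∩ dilate (1 - R ^ (-α)) I') (levelRadius c₁ R (n + 1))) (sel n I')

/-- The families `𝒥_n`: `𝒥_0 = ℐ_0`, and `𝒥_{n+1}` consists of the members of `ℐ_{n+1}(J)`,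
`J ∈ 𝒥_n`, that meet no `Δ(L)` with `L ∈ C(n)`. -/
def familyJ (i j θ c R : ℝ) (𝓢₀ : Set (Set ℝ)) (sel : ℕ → Set ℝ → Set (Set ℝ)) :
    ℕ → Set (Set ℝ)
  | 0 => 𝓢₀
  | n + 1 => {I | (∃ J ∈ familyJ i j θ c R 𝓢₀ sel n, I ∈ sel n J) ∧
      ∀ A B C : ℤ, LineClass i j R n A B C → danger i j θ c A B C ∩ I = ∅}

/-! ### Tree-like families -/

/-- `𝒯_n(J)` is the set of members of level `n` contained in `J`. -/
def inside (𝒯 : ℕ → Set (Set ℝ)) (n : ℕ) (J : Set ℝ) : Set (Set ℝ) := {I | I ∈ 𝒯 n ∧ I ⊆ J}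

/-- A tree-like family of closed intervals with root `J₀`. -/
structure TreeLike (𝒯 : ℕ → Set (Set ℝ)) (J₀ : Set ℝ) : Prop where
  root : 𝒯 0 = {J₀}
  closed_interval : ∀ n, ∀ I ∈ 𝒯 n, ∃ a b : ℝ, a ≤ b ∧ I = Icc a b
  length_pos : ∀ n, ∀ I ∈ 𝒯 n, 0 < Metric.diam I
  almost_disjoint : ∀ n, ∀ I₁ ∈ 𝒯 (n + 1), ∀ I₂ ∈ 𝒯 (n + 1),
    I₁ = I₂ ∨ (I₁ ∩ I₂).Subsingleton
  parent : ∀ n, ∀ I ∈ 𝒯 (n + 1), ∃ J ∈ 𝒯 n, I ⊆ J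
  child : ∀ n, ∀ J ∈ 𝒯 n, (inside 𝒯 (n + 1) J).Nonempty

/-- Regularity of degree `r`: every member has exactly `r` members of the next level inside it. -/
def Regular (𝒯 : ℕ → Set (Set ℝ)) (r : ℕ) : Prop :=
  ∀ n, ∀ J ∈ 𝒯 n, (inside 𝒯 (n + 1) J).encard = r

end VerticalCantor

end

noncomputable section

namespace VerticalCantor

/-! ### Lines with integer coefficients -/

/-! Let f(n) be the number of tree intervals of level n that survive, that is, belong to 𝒥_n. The
stronger claim is f(n+1) ≥ R^(β-ε) f(n), by strong induction starting from f(0) = 1. Every survivor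
has at least 3R^(β-ε) children, so it suffices that at most 2R^(β-ε) f(n) children are lost at each
step.

A lost child contains a point y that is dangerous for a line of C(n); take such a line in the lowest
possible dyadic range of heights. It lies in a block: heights in [h, 2h), B in (b, 2b], with an
index l such that b^(1+j) ≤ R^(nj-l). The losses due to a block of index l are counted inside the
surviving ancestors of level n-l. There `card_le_of_block` gives a dichotomy. If the lines of the
block cross x = θ at well separated points, the power law bounds both the number of lines and the
number of children near each. Otherwise two lines cross x = θ close together. On an interval of
level n-l the coefficient determinants of three dangerous lines of the block are integers of
absolute value less than 1, so all these lines pass through one rational point P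
(`det_and_cross_of_block`). If the denominator of P were small, a pigeonhole argument would give a
line through P that is either of smaller height and dangerous at y, or vertical and in conflict with
the bad approximability of θ (`exists_line_of_small_denominator`). Hence the denominator is large, θ
is very close to the abscissa of P, and all lines of the block cross x = θ in one short interval
(`abs_ordinate_sub_cross_le`).

Either way an ancestor loses at most a constant times R^((β-10ε)(l+1)) children per block
(`card_le_of_level`). By induction f(n-l) ≤ R^(-(β-ε)l) f(n), so the sum over l is geometric with
ratio R^(-9ε), and one spare factor R^(-9ε) pays for the number of blocks, of order (log R)², and
for the powers of b₂/b₁ (`sum_loss_le`). -/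

/-- The value at `(θ, y)` of the linear form `A x - B y + C`. -/
def lineForm (θ : ℝ) (L : ℤ × ℤ × ℤ) (y : ℝ) : ℝ := (L.1 : ℝ) * θ - L.2.1 * y + L.2.2

/-- The ordinate of the point of abscissa `θ` on the line. -/
def ordinate (θ : ℝ) (L : ℤ × ℤ × ℤ) : ℝ := ((L.1 : ℝ) * θ + L.2.2) / L.2.1

/-- The first coordinate (up to the common denominator `crossZ`) of the intersection point. -/
def crossX (L₁ L₂ : ℤ × ℤ × ℤ) : ℤ := L₁.2.1 * L₂.2.2 - L₂.2.1 * L₁.2.2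

/-- The second coordinate (up to the common denominator `crossZ`) of the intersection point. -/
def crossY (L₁ L₂ : ℤ × ℤ × ℤ) : ℤ := L₁.1 * L₂.2.2 - L₂.1 * L₁.2.2

/-- The common denominator of the coordinates of the intersection point of two lines. -/
def crossZ (L₁ L₂ : ℤ × ℤ × ℤ) : ℤ := L₁.1 * L₂.2.1 - L₂.1 * L₁.2.1

/-- The determinant of the coefficients of three lines. -/
def lineDet (L₁ L₂ L : ℤ × ℤ × ℤ) : ℤ :=
  L.1 * crossX L₁ L₂ - L.2.1 * crossY L₁ L₂ + L.2.2 * crossZ L₁ L₂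

theorem lineForm_eq_mul_sub (θ : ℝ) (L : ℤ × ℤ × ℤ) (y : ℝ) (hB : 0 < L.2.1) :
    lineForm θ L y = L.2.1 * (ordinate θ L - y) := by
  have : (0 : ℝ) < L.2.1 := by exact_mod_cast hB
  unfold lineForm ordinate
  field_simp
  ring

/-- Cramer's rule: if both lines pass near (θ, y), then θ is near the rational abscissa of their
intersection. The ordinate y is free, since it cancels on the right. -/
theorem crossZ_mul_sub_crossX (θ : ℝ) (L₁ L₂ : ℤ × ℤ × ℤ) (y : ℝ) :
    (crossZ L₁ L₂ : ℝ) * θ - crossX L₁ L₂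
      = L₂.2.1 * lineForm θ L₁ y - L₁.2.1 * lineForm θ L₂ y := by
  simp only [crossZ, crossX, lineForm]; push_cast; ring

theorem crossZ_mul_sub_crossY (θ : ℝ) (L₁ L₂ : ℤ × ℤ × ℤ) (y : ℝ) :
    (crossZ L₁ L₂ : ℝ) * y - crossY L₁ L₂
      = L₂.1 * lineForm θ L₁ y - L₁.1 * lineForm θ L₂ y := by
  simp only [crossZ, crossY, lineForm]; push_cast; ring

theorem abs_mul_sub_mul_le {x₁ x₂ y₁ y₂ X Y : ℝ} (hx₁ : |x₁| ≤ X) (hx₂ : |x₂| ≤ X)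
    (hy₁ : |y₁| ≤ Y) (hy₂ : |y₂| ≤ Y) : |x₁ * y₂ - x₂ * y₁| ≤ 2 * X * Y := by
  have hX : 0 ≤ X := (abs_nonneg _).trans hx₁
  calc |x₁ * y₂ - x₂ * y₁| ≤ |x₁ * y₂| + |x₂ * y₁| := abs_sub _ _
    _ = |x₁| * |y₂| + |x₂| * |y₁| := by rw [abs_mul, abs_mul]
    _ ≤ X * Y + X * Y := by gcongr
    _ = 2 * X * Y := by ring

/-- Column operations replace the constant terms by the values of the three forms at (θ, y).
Expanding along that column gives three products of a minor of size at most 2ab and a value of size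
at most e, so the integer determinant is less than 1 in absolute value. -/
theorem lineDet_eq_zero (θ y : ℝ) {a b e : ℝ} (L₁ L₂ L₃ : ℤ × ℤ × ℤ)
    (hA₁ : |(L₁.1 : ℝ)| ≤ a) (hA₂ : |(L₂.1 : ℝ)| ≤ a) (hA₃ : |(L₃.1 : ℝ)| ≤ a)
    (hB₁ : |(L₁.2.1 : ℝ)| ≤ b) (hB₂ : |(L₂.2.1 : ℝ)| ≤ b) (hB₃ : |(L₃.2.1 : ℝ)| ≤ b)
    (he₁ : |lineForm θ L₁ y| ≤ e) (he₂ : |lineForm θ L₂ y| ≤ e) (he₃ : |lineForm θ L₃ y| ≤ e)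
    (h : 6 * a * b * e < 1) : lineDet L₁ L₂ L₃ = 0 := by
  have he : 0 ≤ e := (abs_nonneg _).trans he₁
  have ha : 0 ≤ a := (abs_nonneg _).trans hA₁
  have hb : 0 ≤ b := (abs_nonneg _).trans hB₁
  have key : ((lineDet L₁ L₂ L₃ : ℤ) : ℝ) =
      ((L₂.1 : ℝ) * L₃.2.1 - L₃.1 * L₂.2.1) * lineForm θ L₁ y
      + ((L₃.1 : ℝ) * L₁.2.1 - L₁.1 * L₃.2.1) * lineForm θ L₂ y
      + ((L₁.1 : ℝ) * L₂.2.1 - L₂.1 * L₁.2.1) * lineForm θ L₃ y := by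
    simp only [lineDet, crossX, crossY, crossZ, lineForm]; push_cast; ring
  have h1 := abs_mul_sub_mul_le hA₂ hA₃ hB₂ hB₃
  have h2 := abs_mul_sub_mul_le hA₃ hA₁ hB₃ hB₁
  have h3 := abs_mul_sub_mul_le hA₁ hA₂ hB₁ hB₂
  have : |((lineDet L₁ L₂ L₃ : ℤ) : ℝ)| < 1 := by
    rw [key]
    refine lt_of_le_of_lt (abs_add_three _ _ _) ?_
    rw [abs_mul, abs_mul, abs_mul]
    have : 2 * a * b * e + 2 * a * b * e + 2 * a * b * e < 1 := by linarith
    refine lt_of_le_of_lt ?_ this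
    gcongr
  have h' : |lineDet L₁ L₂ L₃| < 1 := by exact_mod_cast this
  exact Int.abs_lt_one_iff.1 h'

/-- Two distinct lines in normal form that pass close to a common point are not parallel. -/
theorem crossZ_ne_zero (θ y : ℝ) {b e : ℝ} (L₁ L₂ : ℤ × ℤ × ℤ)
    (hg₁ : Int.gcd L₁.1 (Int.gcd L₁.2.1 L₁.2.2) = 1)
    (hg₂ : Int.gcd L₂.1 (Int.gcd L₂.2.1 L₂.2.2) = 1)
    (hpos₁ : 0 < L₁.2.1) (hpos₂ : 0 < L₂.2.1) (hne : L₁ ≠ L₂)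
    (hB₁ : |(L₁.2.1 : ℝ)| ≤ b) (hB₂ : |(L₂.2.1 : ℝ)| ≤ b)
    (he₁ : |lineForm θ L₁ y| ≤ e) (he₂ : |lineForm θ L₂ y| ≤ e)
    (h : 2 * b * e < 1) : crossZ L₁ L₂ ≠ 0 := by
  intro hz
  have hx : crossX L₁ L₂ = 0 := by
    have h1 := crossZ_mul_sub_crossX θ L₁ L₂ y
    rw [hz] at h1
    have h2 : |(crossX L₁ L₂ : ℝ)| < 1 := by
      have h3 : (crossX L₁ L₂ : ℝ)
          = L₁.2.1 * lineForm θ L₂ y - L₂.2.1 * lineForm θ L₁ y := by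
        push_cast at h1; linarith
      rw [h3]
      exact lt_of_le_of_lt (abs_mul_sub_mul_le hB₁ hB₂ he₁ he₂) h
    have h' : |crossX L₁ L₂| < 1 := by exact_mod_cast h2
    exact Int.abs_lt_one_iff.1 h'
  obtain ⟨A₁, B₁, C₁⟩ := L₁
  obtain ⟨A₂, B₂, C₂⟩ := L₂
  simp only [crossZ, crossX] at hz hx hg₁ hg₂ hpos₁ hpos₂ hne
  -- The vanishing minors make B divide each of B'A, B'B and B'C, hence by Bézout B' times the gcd,
  -- which is 1. Used in both directions, this gives equal B, and then equal lines.
  have hdvd : ∀ {A B C A' B' C' : ℤ}, Int.gcd A (Int.gcd B C) = 1 →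
      A * B' - A' * B = 0 → B * C' - B' * C = 0 → B ∣ B' := by
    intro A B C A' B' C' hg h1 h2
    have hb : Int.gcd A (Int.gcd B C) = 1 := hg
    have e1 : B ∣ B' * A := ⟨A', by linarith⟩
    have e2 : B ∣ B' * B := ⟨B', by ring⟩
    have e3 : B ∣ B' * C := ⟨C', by linarith⟩
    have h4 : B ∣ B' * (Int.gcd B C : ℤ) := by
      rw [Int.gcd_eq_gcd_ab]
      have : B' * (B * Int.gcdA B C + C * Int.gcdB B C)
        = (B' * B) * Int.gcdA B C + (B' * C) * Int.gcdB B C := by ring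
      rw [this]
      exact dvd_add (e2.mul_right _) (e3.mul_right _)
    have h5 : B ∣ B' * (Int.gcd A (Int.gcd B C) : ℤ) := by
      rw [Int.gcd_eq_gcd_ab]
      generalize (Int.gcd B C : ℤ) = G at *
      have : B' * (A * Int.gcdA A G + G * Int.gcdB A G)
        = (B' * A) * Int.gcdA A G + (B' * G) * Int.gcdB A G := by ring
      rw [this]
      exact dvd_add (e1.mul_right _) (h4.mul_right _)
    rw [hb] at h5
    simpa using h5
  have d1 : B₁ ∣ B₂ := hdvd hg₁ hz hx
  have d2 : B₂ ∣ B₁ := hdvd (A' := A₁) (C' := C₁) hg₂ (by linarith) (by linarith)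
  have hB : B₁ = B₂ := Int.dvd_antisymm hpos₁.le hpos₂.le d1 d2
  subst hB
  apply hne
  have hA : A₁ = A₂ := by
    have : (A₁ - A₂) * B₁ = 0 := by linarith
    rcases mul_eq_zero.1 this with h | h <;> omega
  have hC : C₁ = C₂ := by
    have : (C₂ - C₁) * B₁ = 0 := by linarith
    rcases mul_eq_zero.1 this with h | h <;> omega
  rw [hA, hC]

/-! ### Lines of small height through a rational point -/

/-- A pigeonhole argument: through a rational point there is a line with small coefficients. -/
theorem exists_small_line (p r D : ℤ) (hD : D ≠ 0) {a b : ℝ} (ha : 0 < a) (hb : 0 < b)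
    (hab : |(D : ℝ)| ≤ a * b) :
    ∃ L : ℤ × ℤ × ℤ, (L.1 ≠ 0 ∨ L.2.1 ≠ 0) ∧ 0 ≤ L.2.1 ∧ |(L.1 : ℝ)| ≤ a ∧ |(L.2.1 : ℝ)| ≤ b ∧
      L.1 * p - L.2.1 * r + L.2.2 * D = 0 := by
  -- There are more than ab ≥ |D| pairs in this box, so two of them give the same residue of A p - B
  -- r modulo D; their difference is the line.
  set S : Finset (ℕ × ℕ) := Finset.range (⌊a⌋₊ + 1) ×ˢ Finset.range (⌊b⌋₊ + 1) with hS
  set T : Finset ℤ := Finset.Ico 0 |D| with hT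
  have hcard : T.card < S.card := by
    rw [hS, hT, Finset.card_product, Finset.card_range, Finset.card_range, Int.card_Ico, sub_zero]
    have h1 : a < ⌊a⌋₊ + 1 := Nat.lt_floor_add_one a
    have h2 : b < ⌊b⌋₊ + 1 := Nat.lt_floor_add_one b
    have h3 : (|D| : ℝ) < ((⌊a⌋₊ + 1) * (⌊b⌋₊ + 1) : ℕ) := by
      push_cast
      calc (|D| : ℝ) ≤ a * b := hab
        _ < _ := by gcongr
    have h4 : |D| < (((⌊a⌋₊ + 1) * (⌊b⌋₊ + 1) : ℕ) : ℤ) := by exact_mod_cast h3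
    have : 0 ≤ |D| := abs_nonneg _
    omega
  have hmaps : ∀ x ∈ S, ((x.1 : ℤ) * p - x.2 * r) % |D| ∈ T := by
    intro x _
    rw [hT, Finset.mem_Ico]
    exact ⟨Int.emod_nonneg _ (abs_ne_zero.2 hD), Int.emod_lt_of_pos _ (abs_pos.2 hD)⟩
  obtain ⟨x, hx, y, hy, hne, hxy⟩ := Finset.exists_ne_map_eq_of_card_lt_of_maps_to hcard hmaps
  wlog hle : y.2 ≤ x.2 generalizing x y
  · exact this y hy x hx hne.symm hxy.symm (by omega)
  have hdvd : D ∣ ((x.1 : ℤ) * p - x.2 * r) - ((y.1 : ℤ) * p - y.2 * r) := by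
    rw [← abs_dvd]
    exact Int.ModEq.dvd (show _ ≡ _ [ZMOD |D|] from hxy.symm)
  obtain ⟨k, hk⟩ := hdvd
  rw [hS, Finset.mem_product, Finset.mem_range, Finset.mem_range] at hx hy
  have bound : ∀ {u v : ℕ} {t : ℝ}, 0 < t → u < ⌊t⌋₊ + 1 → v < ⌊t⌋₊ + 1 →
      |(((u : ℤ) - v : ℤ) : ℝ)| ≤ t := by
    intro u v t ht hu hv
    have hu' : (u : ℝ) ≤ t := (Nat.le_floor_iff ht.le).1 (by omega)
    have hv' : (v : ℝ) ≤ t := (Nat.le_floor_iff ht.le).1 (by omega)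
    push_cast
    rw [abs_le]
    constructor <;> linarith [(Nat.cast_nonneg u : (0 : ℝ) ≤ u), (Nat.cast_nonneg v : (0 : ℝ) ≤ v)]
  refine ⟨((x.1 : ℤ) - y.1, (x.2 : ℤ) - y.2, -k), ?_, ?_, bound ha hx.1 hy.1, bound hb hx.2 hy.2, ?_⟩
  · by_contra hcon
    push Not at hcon
    apply hne
    simp only at hcon
    ext <;> omega
  · simp only; omega
  · simp only; linarith

/-- Dividing the coefficients by their greatest common divisor. -/
theorem exists_primitive (L : ℤ × ℤ × ℤ) (hB : 0 < L.2.1) :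
    ∃ L' : ℤ × ℤ × ℤ, Int.gcd L'.1 (Int.gcd L'.2.1 L'.2.2) = 1 ∧ 0 < L'.2.1 ∧
      |(L'.1 : ℝ)| ≤ |(L.1 : ℝ)| ∧ |(L'.2.1 : ℝ)| ≤ |(L.2.1 : ℝ)| ∧
      ∀ θ y, |lineForm θ L' y| ≤ |lineForm θ L y| := by
  obtain ⟨A, B, C⟩ := L
  simp only at hB
  obtain ⟨g, hg⟩ : ∃ g : ℕ, g = Int.gcd A (Int.gcd B C) := ⟨_, rfl⟩
  have hgA : (g : ℤ) ∣ A := hg ▸ Int.gcd_dvd_left _ _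
  have hgBC : (g : ℤ) ∣ (Int.gcd B C : ℤ) := hg ▸ Int.gcd_dvd_right _ _
  have hgB : (g : ℤ) ∣ B := hgBC.trans (Int.gcd_dvd_left _ _)
  have hgC : (g : ℤ) ∣ C := hgBC.trans (Int.gcd_dvd_right _ _)
  have hg0 : 0 < g := Nat.pos_of_ne_zero fun h => by
    rw [h] at hgB; simp at hgB; omega
  obtain ⟨A', rfl⟩ := hgA
  obtain ⟨B', rfl⟩ := hgB
  obtain ⟨C', rfl⟩ := hgC
  have hgR : (1 : ℝ) ≤ g := by exact_mod_cast hg0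
  have key : ∀ x : ℝ, |x| ≤ |(g : ℝ) * x| := by
    intro x
    rw [abs_mul, Nat.abs_cast]
    exact le_mul_of_one_le_left (abs_nonneg _) hgR
  refine ⟨(A', B', C'), ?_, ?_, ?_, ?_, ?_⟩
  · simp only
    rw [Int.gcd_mul_left, Nat.cast_mul] at hg
    simp only [Int.natAbs_natCast] at hg
    rw [Int.gcd_mul_left, Int.natAbs_natCast] at hg
    exact Nat.eq_of_mul_eq_mul_left hg0 (by omega)
  · exact pos_of_mul_pos_right hB (by positivity)
  · simpa using key A'
  · simpa using key B'
  · intro θ y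
    have := key (lineForm θ (A', B', C') y)
    refine this.trans_eq ?_
    simp only [lineForm]; push_cast; ring_nf

theorem one_le_weight (i j : ℝ) (hj : 0 < j) (A B : ℤ) (hB : 0 < B) : 1 ≤ weight i j A B := by
  refine le_max_of_le_right (Real.one_le_rpow ?_ (by positivity))
  have : (1 : ℤ) ≤ |B| := Int.one_le_abs hB.ne'
  exact_mod_cast this

theorem weight_le {i j x : ℝ} (hi : 0 < i) (hj : 0 < j) (hx : 0 ≤ x) {A B : ℤ}
    (hA : |(A : ℝ)| ≤ x ^ i) (hB : |(B : ℝ)| ≤ x ^ j) : weight i j A B ≤ x := by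
  refine max_le ?_ ?_
  · calc |(A : ℝ)| ^ (1 / i) ≤ (x ^ i) ^ (1 / i) := by gcongr
      _ = x := by rw [← Real.rpow_mul hx, mul_one_div_cancel hi.ne', Real.rpow_one]
  · calc |(B : ℝ)| ^ (1 / j) ≤ (x ^ j) ^ (1 / j) := by gcongr
      _ = x := by rw [← Real.rpow_mul hx, mul_one_div_cancel hj.ne', Real.rpow_one]

theorem abs_le_weight_rpow_left {i j : ℝ} (hi : 0 < i) (A B : ℤ) :
    |(A : ℝ)| ≤ weight i j A B ^ i := by
  calc |(A : ℝ)| = (|(A : ℝ)| ^ (1 / i)) ^ i := by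
        rw [← Real.rpow_mul (abs_nonneg _), one_div_mul_cancel hi.ne', Real.rpow_one]
    _ ≤ _ := by
        gcongr
        exact le_max_left _ _

theorem abs_le_weight_rpow_right {i j : ℝ} (hj : 0 < j) (A B : ℤ) :
    |(B : ℝ)| ≤ weight i j A B ^ j := by
  calc |(B : ℝ)| = (|(B : ℝ)| ^ (1 / j)) ^ j := by
        rw [← Real.rpow_mul (abs_nonneg _), one_div_mul_cancel hj.ne', Real.rpow_one]
    _ ≤ _ := by
        gcongr
        exact le_max_right _ _

/-- If `(θ, y)` is close to a rational point of small denominator, then it is close to a line of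
small height. -/
theorem exists_line_of_small_denominator {i j θ cθ c : ℝ} (hi : 0 < i) (hj : 0 < j)
    (hij : i + j = 1) (hθ : BadWitness i θ cθ) (hcc : c ≤ cθ) {m b e σ y : ℝ}
    (hm : 0 < m) (hb : 0 < b) (hbm : b ≤ m ^ j) (hσ : 0 < σ) (he : 0 ≤ e) (p r D : ℤ)
    (hD : |(D : ℝ)| = σ * m ^ i * b) (hp : |D * θ - p| ≤ 4 * b * e)
    (hr : |D * y - r| ≤ 2 * m ^ i * e)
    (hsmall : σ * m * (e * (4 * σ ^ (-j) + 2 * σ ^ (-i))) ≤ c) :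
    ∃ L : ℤ × ℤ × ℤ, Int.gcd L.1 (Int.gcd L.2.1 L.2.2) = 1 ∧ 0 < L.2.1 ∧
      height i j L.1 L.2.1 ≤ σ ^ (1 + j) * b * m ∧
      |lineForm θ L y| ≤ c / weight i j L.1 L.2.1 := by
  have hσm : 0 < σ * m := by positivity
  have hD0 : D ≠ 0 := by
    rintro rfl
    have : 0 < σ * m ^ i * b := by positivity
    rw [Int.cast_zero, abs_zero] at hD
    linarith
  have hsum : σ ^ i * σ ^ j = σ := by rw [← Real.rpow_add hσ, hij, Real.rpow_one]
  -- The sides of the box multiply exactly to |D|, because σ^i σ^j = σ. They are chosen so that the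
  -- weight of the line found is at most σ m.
  obtain ⟨L, hne, hB0, hA, hB, hP⟩ := exists_small_line p r D hD0
    (a := (σ * m) ^ i) (b := σ ^ j * b) (by positivity) (by positivity) (by
      rw [hD, Real.mul_rpow hσ.le hm.le]
      apply le_of_eq
      calc σ * m ^ i * b = (σ ^ i * σ ^ j) * m ^ i * b := by rw [hsum]
        _ = _ := by ring)
  have hform : |lineForm θ L y| ≤ e * (4 * σ ^ (-j) + 2 * σ ^ (-i)) := by
    have hPR : (L.1 : ℝ) * p - L.2.1 * r + L.2.2 * D = 0 := by exact_mod_cast hP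
    have h1 : lineForm θ L y * D = L.1 * (D * θ - p) - L.2.1 * (D * y - r) := by
      unfold lineForm; linear_combination hPR
    have h2 : |lineForm θ L y| * |(D : ℝ)|
        ≤ (σ * m) ^ i * (4 * b * e) + σ ^ j * b * (2 * m ^ i * e) := by
      rw [← abs_mul, h1]
      refine (abs_sub _ _).trans ?_
      rw [abs_mul, abs_mul]
      gcongr
    have e1 : σ ^ (-j) * σ = σ ^ i := by
      nth_rewrite 2 [← Real.rpow_one σ]
      rw [← Real.rpow_add hσ]; congr 1; linarith
    have e2 : σ ^ (-i) * σ = σ ^ j := by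
      nth_rewrite 2 [← Real.rpow_one σ]
      rw [← Real.rpow_add hσ]; congr 1; linarith
    have hDpos : 0 < |(D : ℝ)| := by rw [hD]; positivity
    refine le_of_mul_le_mul_right (h2.trans_eq ?_) hDpos
    rw [hD, Real.mul_rpow hσ.le hm.le, ← e1, ← e2]
    ring
  have hB' : |(L.2.1 : ℝ)| ≤ (σ * m) ^ j := by
    rw [Real.mul_rpow hσ.le hm.le]
    exact hB.trans (by gcongr)
  -- A vertical line would give |A|^(1/i) |Aθ + C| ≤ c ≤ c(θ), against the bad approximability of θ.
  rcases hB0.eq_or_lt with hB0 | hB0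
  · exfalso
    have hA0 : L.1 ≠ 0 := by
      rcases hne with h | h
      · exact h
      · exact absurd hB0.symm h
    have hform' : lineForm θ L y = L.1 * θ + L.2.2 := by
      unfold lineForm; rw [← hB0]; simp
    have hAw : |(L.1 : ℝ)| ^ (1 / i) ≤ σ * m := by
      calc |(L.1 : ℝ)| ^ (1 / i) ≤ ((σ * m) ^ i) ^ (1 / i) := by gcongr
        _ = σ * m := by rw [← Real.rpow_mul hσm.le, mul_one_div_cancel hi.ne', Real.rpow_one]
    have hcon : |(L.1 : ℝ)| ^ (1 / i) * |(L.1 : ℝ) * θ + L.2.2| ≤ c := by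
      rw [← hform']
      refine le_trans ?_ hsmall
      gcongr
    have hlow : ∃ p' : ℤ, |(L.1 : ℝ) * θ + L.2.2| = |((L.1.natAbs : ℕ) : ℝ) * θ - p'| := by
      rw [Nat.cast_natAbs, Int.cast_abs]
      rcases abs_choice (L.1 : ℝ) with h | h
      · refine ⟨-L.2.2, ?_⟩
        rw [h]; push_cast; congr 1; ring
      · refine ⟨L.2.2, ?_⟩
        rw [h, ← abs_neg]; congr 1; ring
    obtain ⟨p', hp'⟩ := hlow
    have hbad := hθ.2 p' L.1.natAbs (Int.natAbs_pos.2 hA0)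
    rw [← hp', Nat.cast_natAbs, Int.cast_abs] at hbad
    linarith
  · obtain ⟨L', hg, hpos, hA', hB'', hle⟩ := exists_primitive L hB0
    have hw : weight i j L'.1 L'.2.1 ≤ σ * m :=
      weight_le hi hj hσm.le (hA'.trans hA) (hB''.trans hB')
    have hw1 := one_le_weight i j hj L'.1 L'.2.1 hpos
    refine ⟨L', hg, hpos, ?_, ?_⟩
    · have : (L'.2.1 : ℝ) ≤ σ ^ j * b := (le_abs_self _).trans (hB''.trans hB)
      unfold height
      calc (L'.2.1 : ℝ) * weight i j L'.1 L'.2.1 ≤ (σ ^ j * b) * (σ * m) := by gcongr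
        _ = σ ^ (1 + j) * b * m := by rw [Real.rpow_add hσ, Real.rpow_one]; ring
    · rw [le_div_iff₀ (by linarith)]
      calc |lineForm θ L' y| * weight i j L'.1 L'.2.1
          ≤ (e * (4 * σ ^ (-j) + 2 * σ ^ (-i))) * (σ * m) := by
            gcongr
            exact (hle θ y).trans hform
        _ ≤ c := by linarith

/-! ### Dyadic blocks of lines -/

/-- Lines in normal form with height in `[h, 2h)` and `B ∈ (b, 2b]`. -/
structure InBlock (i j h b : ℝ) (L : ℤ × ℤ × ℤ) : Prop where
  gcd_eq : Int.gcd L.1 (Int.gcd L.2.1 L.2.2) = 1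
  pos : 0 < L.2.1
  height_ge : h ≤ height i j L.1 L.2.1
  height_lt : height i j L.1 L.2.1 < 2 * h
  lt : b < L.2.1
  le : (L.2.1 : ℝ) ≤ 2 * b

namespace InBlock

variable {i j h b : ℝ} {L : ℤ × ℤ × ℤ}

/-- With m = 2h/b, this bound and the next confine all weights in a block to [m/4, m); m is the
natural parameter for the later estimates. -/
theorem weight_lt (H : InBlock i j h b L) (hb : 0 < b) : weight i j L.1 L.2.1 < 2 * h / b := by
  rw [lt_div_iff₀ hb]
  have h1 := H.height_lt
  unfold height at h1
  have hw : 0 ≤ weight i j L.1 L.2.1 :=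
    (Real.rpow_nonneg (abs_nonneg _) _).trans (le_max_left _ _)
  nlinarith [H.lt]

theorem le_weight (H : InBlock i j h b L) (hb : 0 < b) :
    2 * h / b / 4 ≤ weight i j L.1 L.2.1 := by
  rw [div_div, div_le_iff₀ (by positivity)]
  have h1 := H.height_ge
  unfold height at h1
  have hw : 0 ≤ weight i j L.1 L.2.1 :=
    (Real.rpow_nonneg (abs_nonneg _) _).trans (le_max_left _ _)
  nlinarith [H.le]

theorem abs_left_le (H : InBlock i j h b L) (hi : 0 < i) (hb : 0 < b) :
    |(L.1 : ℝ)| ≤ (2 * h / b) ^ i := by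
  refine (abs_le_weight_rpow_left (j := j) hi L.1 L.2.1).trans ?_
  have hw : 0 ≤ weight i j L.1 L.2.1 :=
    (Real.rpow_nonneg (abs_nonneg _) _).trans (le_max_left _ _)
  exact Real.rpow_le_rpow hw (H.weight_lt hb).le hi.le

theorem abs_right_le (H : InBlock i j h b L) : |(L.2.1 : ℝ)| ≤ 2 * b := by
  have : (0 : ℝ) < L.2.1 := by exact_mod_cast H.pos
  rw [abs_of_pos this]
  exact H.le

theorem le_rpow (H : InBlock i j h b L) (hj : 0 < j) (hb : 0 < b) : b ≤ (2 * h / b) ^ j := by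
  have hw : 0 ≤ weight i j L.1 L.2.1 :=
    (Real.rpow_nonneg (abs_nonneg _) _).trans (le_max_left _ _)
  calc b ≤ |(L.2.1 : ℝ)| := H.lt.le.trans (le_abs_self _)
    _ ≤ weight i j L.1 L.2.1 ^ j := abs_le_weight_rpow_right hj _ _
    _ ≤ _ := Real.rpow_le_rpow hw (H.weight_lt hb).le hj.le

theorem abs_lineForm_le (H : InBlock i j h b L) (hb : 0 < b) (hh : 0 < h) {θ c y : ℝ}
    (hc : 0 ≤ c) (hy : |lineForm θ L y| ≤ c / weight i j L.1 L.2.1) :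
    |lineForm θ L y| ≤ 4 * c / (2 * h / b) := by
  refine hy.trans ?_
  have h1 := H.le_weight hb
  have : 0 < 2 * h / b := by positivity
  calc c / weight i j L.1 L.2.1 ≤ c / (2 * h / b / 4) := by gcongr
    _ = _ := by field_simp

theorem abs_ordinate_sub_le (H : InBlock i j h b L) (hj : 0 < j) (hh : 0 < h) {θ c y : ℝ}
    (hy : |lineForm θ L y| ≤ c / weight i j L.1 L.2.1) :
    |ordinate θ L - y| ≤ c / h := by
  have hB : (0 : ℝ) < L.2.1 := by exact_mod_cast H.pos
  have hw := one_le_weight i j hj L.1 L.2.1 H.pos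
  rw [lineForm_eq_mul_sub θ L y H.pos, abs_mul, abs_of_pos hB, le_div_iff₀ (by linarith)] at hy
  rw [le_div_iff₀ hh]
  have := H.height_ge
  unfold height at this
  calc |ordinate θ L - y| * h ≤ |ordinate θ L - y| * (L.2.1 * weight i j L.1 L.2.1) := by gcongr
    _ ≤ c := by linarith

end InBlock

set_option maxHeartbeats 1000000 in
/-- If two lines of a block come close to each other near a point that is not dangerous for any line
of smaller height, then all the lines of the block through their intersection meet the vertical
line in a short interval. -/
theorem abs_ordinate_sub_cross_le {i j θ cθ c h b t y : ℝ} (hi : 0 < i) (hj : 0 < j)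
    (hij : i + j = 1) (hθ : BadWitness i θ cθ) (hc : 0 < c) (hcc : c ≤ cθ) (hh : 0 < h)
    (hb : 0 < b) (ht : 1 ≤ t) {L₁ L₂ : ℤ × ℤ × ℤ} (H₁ : InBlock i j h b L₁)
    (H₂ : InBlock i j h b L₂) (hD : crossZ L₁ L₂ ≠ 0)
    (hy : |lineForm θ L₁ y| ≤ c / weight i j L₁.1 L₁.2.1)
    (hclose : |ordinate θ L₂ - ordinate θ L₁| ≤ t * c / h)
    (hlow : ∀ L : ℤ × ℤ × ℤ, Int.gcd L.1 (Int.gcd L.2.1 L.2.2) = 1 → 0 < L.2.1 →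
      height i j L.1 L.2.1 < h → ¬ |lineForm θ L y| ≤ c / weight i j L.1 L.2.1)
    {L : ℤ × ℤ × ℤ} (H : InBlock i j h b L) (hdet : lineDet L₁ L₂ L = 0) :
    |ordinate θ L - crossY L₁ L₂ / crossZ L₁ L₂| ≤ (48 * t) ^ (1 / (i * j)) * (c / h) := by
  set m : ℝ := 2 * h / b with hm
  have hm0 : 0 < m := by positivity
  set g : ℝ := 48 * t with hg
  have hg1 : 48 ≤ g := by linarith
  have hg0 : 0 < g := by linarith
  set e : ℝ := 8 * t * c / m with he
  have he0 : 0 < e := by positivity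
  set D : ℝ := (crossZ L₁ L₂ : ℝ) with hDdef
  have hD0 : D ≠ 0 := by rw [hDdef]; exact_mod_cast hD
  have hbm : b = 2 * h / m := by rw [hm]; field_simp
  have he₁ : |lineForm θ L₁ y| ≤ e := by
    refine (H₁.abs_lineForm_le hb hh hc.le hy).trans ?_
    rw [← hm, he]
    gcongr
    linarith
  have he₂ : |lineForm θ L₂ y| ≤ e := by
    rw [lineForm_eq_mul_sub θ L₂ y H₂.pos, abs_mul]
    have h1 : |ordinate θ L₂ - y| ≤ 2 * (t * c / h) := by
      have h2 := H₁.abs_ordinate_sub_le hj hh hy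
      have h3 : c / h ≤ t * c / h := by
        gcongr
        nlinarith
      calc |ordinate θ L₂ - y| = |(ordinate θ L₂ - ordinate θ L₁) + (ordinate θ L₁ - y)| := by
            congr 1; ring
        _ ≤ _ := (abs_add_le _ _).trans (by linarith)
    calc |(L₂.2.1 : ℝ)| * |ordinate θ L₂ - y| ≤ (2 * b) * (2 * (t * c / h)) := by
          gcongr
          exact H₂.abs_right_le
      _ = e := by rw [he, hm]; field_simp; ring
  have hmi : 0 < m ^ i := by positivity
  set σ : ℝ := |D| / (m ^ i * b) with hσ
  have hσ0 : 0 < σ := by positivity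
  have hDσ : |D| = σ * m ^ i * b := by rw [hσ]; field_simp
  have hp : |D * θ - crossX L₁ L₂| ≤ 4 * b * e := by
    rw [hDdef, crossZ_mul_sub_crossX θ L₁ L₂ y]
    exact (abs_mul_sub_mul_le H₂.abs_right_le H₁.abs_right_le he₂ he₁).trans_eq (by ring)
  have hr : |D * y - crossY L₁ L₂| ≤ 2 * m ^ i * e := by
    rw [hDdef, crossZ_mul_sub_crossY θ L₁ L₂ y]
    exact (abs_mul_sub_mul_le (H₂.abs_left_le hi hb) (H₁.abs_left_le hi hb) he₂ he₁)
  have hij0 : 0 < i * j := by positivity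
  have hsplit : 1 / (i * j) = 1 / i + 1 / j := by field_simp; linarith
  -- Here σ is the denominator of the intersection point, normalised by its trivial size m^i b. A
  -- smaller σ would produce a dangerous line of height below h.
  have hσlow : g ^ (-(1 / (i * j) - 1)) < σ := by
    by_contra hcon
    push Not at hcon
    have hpow : ∀ {x z : ℝ}, 0 < x → 0 < z → x + z = 1 → 1 / (x * z) = 1 / (i * j) →
        σ ^ x ≤ g⁻¹ := by
      intro x z hx hz hxz hprod
      calc σ ^ x ≤ (g ^ (-(1 / (i * j) - 1))) ^ x := by gcongr
        _ = g ^ (-(1 / (i * j) - 1) * x) := by rw [← Real.rpow_mul hg0.le]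
        _ ≤ g ^ (-1 : ℝ) := by
            refine Real.rpow_le_rpow_of_exponent_le (by linarith) ?_
            rw [← hprod]
            -- Since x + z = 1, z(1 + x) = 1 - x² ≤ 1. This makes the exponent 1/(ij) - 1 large
            -- enough for both σ^i and σ^j to be at most 1/g.
            have : 1 + x ≤ 1 / z := by
              rw [le_div_iff₀ hz]; nlinarith
            have e1 : 1 / (x * z) * x = 1 / z := by field_simp
            nlinarith
        _ = g⁻¹ := Real.rpow_neg_one g
    have hσi : σ ^ i ≤ g⁻¹ := hpow hi hj hij rfl
    have hσj : σ ^ j ≤ g⁻¹ := hpow hj hi (by linarith) (by rw [mul_comm])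
    have hsum : σ ^ i * σ ^ j = σ := by rw [← Real.rpow_add hσ0, hij, Real.rpow_one]
    have hginv : g⁻¹ ≤ 1 / 48 := by
      rw [inv_eq_one_div]; gcongr
    have hσj0 : 0 < σ ^ j := by positivity
    have hσi0 : 0 < σ ^ i := by positivity
    obtain ⟨L₀, hg₀, hB₀, hH₀, hf₀⟩ := exists_line_of_small_denominator hi hj hij hθ hcc hm0 hb
      (H₁.le_rpow hj hb) hσ0 he0.le (crossX L₁ L₂) (crossY L₁ L₂) (crossZ L₁ L₂) hDσ hp hr (by
        have e1 : σ * σ ^ (-j) = σ ^ i := by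
          nth_rewrite 1 [← Real.rpow_one σ]
          rw [← Real.rpow_add hσ0]; congr 1; linarith
        have e2 : σ * σ ^ (-i) = σ ^ j := by
          nth_rewrite 1 [← Real.rpow_one σ]
          rw [← Real.rpow_add hσ0]; congr 1; linarith
        have e3 : m * e = 8 * t * c := by rw [he]; field_simp
        calc σ * m * (e * (4 * σ ^ (-j) + 2 * σ ^ (-i)))
            = (m * e) * (4 * (σ * σ ^ (-j)) + 2 * (σ * σ ^ (-i))) := by ring
          _ = (8 * t * c) * (4 * σ ^ i + 2 * σ ^ j) := by rw [e1, e2, e3]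
          _ ≤ (8 * t * c) * (4 * g⁻¹ + 2 * g⁻¹) := by gcongr
          -- The 48 in g is 8 · (4 + 2): it makes the danger bound come out as exactly c.
          _ = c := by rw [hg]; field_simp; norm_num)
    refine hlow L₀ hg₀ hB₀ (hH₀.trans_lt ?_) hf₀
    have : σ ^ (1 + j) * b * m = 2 * h * (σ * σ ^ j) := by
      rw [Real.rpow_add hσ0, Real.rpow_one, hm]; field_simp
    rw [this]
    have : σ * σ ^ j ≤ 1 / 48 := by
      calc σ * σ ^ j = (σ ^ i * σ ^ j) * σ ^ j := by rw [hsum]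
        _ ≤ (g⁻¹ * g⁻¹) * g⁻¹ := by gcongr
        _ ≤ (1 / 48 * (1 / 48)) * (1 / 48) := by gcongr
        _ ≤ 1 / 48 := by norm_num
    nlinarith
  have hB : (0 : ℝ) < L.2.1 := by exact_mod_cast H.pos
  have hdet' : (L.1 : ℝ) * crossX L₁ L₂ - L.2.1 * crossY L₁ L₂ + L.2.2 * D = 0 := by
    rw [hDdef]; exact_mod_cast hdet
  -- By concurrency L passes through the intersection point, so its ordinate at θ differs from that
  -- of the point by the slope A/B times the horizontal distance.
  have hord : ordinate θ L - crossY L₁ L₂ / D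
      = L.1 * (D * θ - crossX L₁ L₂) / (L.2.1 * D) := by
    unfold ordinate
    field_simp
    linear_combination hdet'
  rw [hord, abs_div, abs_mul, abs_mul, abs_of_pos hB, hDσ]
  calc |(L.1 : ℝ)| * |D * θ - crossX L₁ L₂| / (L.2.1 * (σ * m ^ i * b))
      ≤ m ^ i * (4 * b * e) / (b * (σ * m ^ i * b)) := by
        gcongr
        · exact H.abs_left_le hi hb
        · exact H.lt.le
    _ = 16 * t * σ⁻¹ * (c / h) := by
        rw [he, hm]; field_simp; ring
    _ ≤ g * g ^ (1 / (i * j) - 1) * (c / h) := by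
        have : σ⁻¹ ≤ g ^ (1 / (i * j) - 1) := by
          rw [Real.rpow_neg hg0.le] at hσlow
          exact (inv_le_comm₀ hσ0 (by positivity)).2 hσlow.le
        gcongr
        linarith
    _ = g ^ (1 / (i * j)) * (c / h) := by
        nth_rewrite 1 [← Real.rpow_one g]
        rw [← Real.rpow_add hg0]
        congr 2; ring

/-- Three lines of a block that are dangerous for points of a short interval are concurrent, and two
distinct ones are not parallel. -/
theorem det_and_cross_of_block {i j θ c h b ρ y₀ : ℝ} (hi : 0 < i) (hj : 0 < j)
    (hij : i + j = 1) (hc : 0 < c) (hh : 0 < h) (hb : 0 < b)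
    (hsmall : 48 * c + 24 * ((2 * h / b) ^ i * b ^ 2 * ρ) < 1) {L₁ L₂ L₃ : ℤ × ℤ × ℤ}
    (H₁ : InBlock i j h b L₁) (H₂ : InBlock i j h b L₂) (H₃ : InBlock i j h b L₃)
    (h₁ : ∃ y, |y - y₀| ≤ ρ ∧ |lineForm θ L₁ y| ≤ c / weight i j L₁.1 L₁.2.1)
    (h₂ : ∃ y, |y - y₀| ≤ ρ ∧ |lineForm θ L₂ y| ≤ c / weight i j L₂.1 L₂.2.1)
    (h₃ : ∃ y, |y - y₀| ≤ ρ ∧ |lineForm θ L₃ y| ≤ c / weight i j L₃.1 L₃.2.1) :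
    lineDet L₁ L₂ L₃ = 0 ∧ (L₁ ≠ L₂ → crossZ L₁ L₂ ≠ 0) := by
  set m : ℝ := 2 * h / b with hm
  have hm0 : 0 < m := by positivity
  have hbm : b ≤ m ^ j := H₁.le_rpow hj hb
  have hρ : 0 ≤ ρ := by
    obtain ⟨y, hy, -⟩ := h₁
    exact (abs_nonneg _).trans hy
  have hm1 : 1 ≤ m := (one_le_weight i j hj _ _ H₁.pos).trans (H₁.weight_lt hb).le
  -- The three lines are dangerous at different points; moving each to the common y₀ costs at most
  -- 2bρ.
  have hform : ∀ {L : ℤ × ℤ × ℤ}, InBlock i j h b L →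
      (∃ y, |y - y₀| ≤ ρ ∧ |lineForm θ L y| ≤ c / weight i j L.1 L.2.1) →
      |lineForm θ L y₀| ≤ 4 * c / m + 2 * b * ρ := by
    rintro L H ⟨y, hy, hL⟩
    have h1 := H.abs_lineForm_le hb hh hc.le hL
    have h2 : lineForm θ L y₀ = lineForm θ L y + L.2.1 * (y - y₀) := by
      unfold lineForm; ring
    rw [h2]
    refine (abs_add_le _ _).trans ?_
    rw [abs_mul]
    have := H.abs_right_le
    gcongr
  have hmij : m ^ i * m ^ j = m := by rw [← Real.rpow_add hm0, hij, Real.rpow_one]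
  have hmi0 : 0 < m ^ i := by positivity
  have hmi1 : 1 ≤ m ^ i := Real.one_le_rpow hm1 hi.le
  have hq : m ^ i * b * (4 * c / m) ≤ 4 * c := by
    calc m ^ i * b * (4 * c / m) ≤ m ^ i * m ^ j * (4 * c / m) := by gcongr
      _ = 4 * c := by rw [hmij]; field_simp
  have hq' : 0 ≤ m ^ i * b ^ 2 * ρ := by positivity
  constructor
  · refine lineDet_eq_zero θ y₀ L₁ L₂ L₃ (H₁.abs_left_le hi hb) (H₂.abs_left_le hi hb)
      (H₃.abs_left_le hi hb) H₁.abs_right_le H₂.abs_right_le H₃.abs_right_le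
      (hform H₁ h₁) (hform H₂ h₂) (hform H₃ h₃) ?_
    calc 6 * m ^ i * (2 * b) * (4 * c / m + 2 * b * ρ)
        = 12 * (m ^ i * b * (4 * c / m)) + 24 * (m ^ i * b ^ 2 * ρ) := by ring
      _ < 1 := by linarith
  · intro hne
    refine crossZ_ne_zero θ y₀ L₁ L₂ H₁.gcd_eq H₂.gcd_eq H₁.pos H₂.pos hne H₁.abs_right_le
      H₂.abs_right_le (hform H₁ h₁) (hform H₂ h₂) ?_
    have h5 : 0 ≤ 4 * c / m + 2 * b * ρ := by positivity
    calc 2 * (2 * b) * (4 * c / m + 2 * b * ρ)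
        = 1 * (4 * b * (4 * c / m + 2 * b * ρ)) := by ring
      _ ≤ m ^ i * (4 * b * (4 * c / m + 2 * b * ρ)) := by gcongr
      _ = 4 * (m ^ i * b * (4 * c / m)) + 8 * (m ^ i * b ^ 2 * ρ) := by ring
      _ < 1 := by linarith

/-! ### Consequences of the power law -/

namespace PowerLaw

variable {μ : Measure ℝ} {β b₁ b₂ : ℝ}

/-- A separated set of points of the support in a short interval has bounded cardinality. -/
theorem card_le (hpow : PowerLaw μ β b₁ b₂) {ι : Type*} (S : Finset ι) (x : ι → ℝ)
    (hx : ∀ a ∈ S, x a ∈ μ.support) {r d z : ℝ} (hr : 0 < r) (hd : 0 ≤ d) (hlt : 2 * d + r < 1)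
    (hsep : ∀ a ∈ S, ∀ a' ∈ S, a ≠ a' → 2 * r < |x a - x a'|) (hz : ∀ a ∈ S, |x a - z| ≤ d) :
    (S.card : ℝ) ≤ b₂ / b₁ * ((2 * d + r) / r) ^ β := by
  have hb₁ := hpow.lower_pos
  have hb₂ := hpow.upper_pos
  have hrβ : 0 < r ^ β := by positivity
  rcases S.eq_empty_or_nonempty with rfl | ⟨a₀, ha₀⟩
  · simp; positivity
  have hdisj : (S : Set ι).PairwiseDisjoint fun a => Metric.closedBall (x a) r := by
    intro a ha a' ha' hne
    refine Metric.closedBall_disjoint_closedBall ?_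
    rw [Real.dist_eq]
    linarith [hsep a ha a' ha' hne]
  -- The upper power law holds only at points of the support, so the large ball is centred at a
  -- member of the family rather than at z; hence 2d instead of d.
  have hsub : ⋃ a ∈ S, Metric.closedBall (x a) r ⊆ Metric.closedBall (x a₀) (2 * d + r) := by
    refine iUnion₂_subset fun a ha => Metric.closedBall_subset_closedBall' ?_
    rw [Real.dist_eq]
    have h1 := abs_le.1 (hz a ha)
    have h2 := abs_le.1 (hz a₀ ha₀)
    have : |x a - x a₀| ≤ 2 * d := abs_le.2 ⟨by linarith, by linarith⟩
    linarith
  have hmeas : (S.card : ENNReal) * ENNReal.ofReal (b₁ * r ^ β)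
      ≤ ENNReal.ofReal (b₂ * (2 * d + r) ^ β) := by
    calc (S.card : ENNReal) * ENNReal.ofReal (b₁ * r ^ β)
        = ∑ a ∈ S, ENNReal.ofReal (b₁ * r ^ β) := by rw [Finset.sum_const, nsmul_eq_mul]
      _ ≤ ∑ a ∈ S, μ (Metric.closedBall (x a) r) :=
          Finset.sum_le_sum fun a ha => hpow.lower _ (hx a ha) r hr (by linarith)
      _ = μ (⋃ a ∈ S, Metric.closedBall (x a) r) :=
          (measure_biUnion_finset hdisj fun a _ => Metric.isClosed_closedBall.measurableSet).symm
      _ ≤ μ (Metric.closedBall (x a₀) (2 * d + r)) := measure_mono hsub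
      _ ≤ _ := hpow.upper _ (hx a₀ ha₀) _ (by linarith) hlt
  rw [← ENNReal.ofReal_natCast, ← ENNReal.ofReal_mul (by positivity),
    ENNReal.ofReal_le_ofReal_iff (by positivity)] at hmeas
  rw [Real.div_rpow (by positivity) hr.le, div_mul_div_comm, le_div_iff₀ (by positivity)]
  linarith

theorem lower_le_upper [IsProbabilityMeasure μ] (hpow : PowerLaw μ β b₁ b₂) : b₁ ≤ b₂ := by
  obtain ⟨x, hx⟩ := Measure.nonempty_support (IsProbabilityMeasure.ne_zero μ)
  have h := (hpow.lower x hx (1 / 2) (by norm_num) (by norm_num)).trans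
    (hpow.upper x hx (1 / 2) (by norm_num) (by norm_num))
  have hb₂ := hpow.upper_pos
  rw [ENNReal.ofReal_le_ofReal_iff (by positivity)] at h
  exact le_of_mul_le_mul_right h (by positivity)

/-- Cut [0,1] into about N intervals of length 1/N: one has mass at least 1/(N+1) and lies in a ball
of radius 1/N about a support point, so N^(β-1) stays bounded as N grows. The numerical estimates
rely on β ≤ 1. -/
theorem exponent_le_one [IsProbabilityMeasure μ] (hpow : PowerLaw μ β b₁ b₂)
    (hμ : μ (Icc (0 : ℝ) 1)ᶜ = 0) : β ≤ 1 := by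
  by_contra hβ
  push Not at hβ
  have key : ∀ N : ℕ, 2 ≤ N → (N : ℝ) ^ (β - 1) ≤ 2 * b₂ := by
    intro N hN
    have hN0 : (0 : ℝ) < N := by positivity
    have hcover : Icc (0 : ℝ) 1 ⊆ ⋃ k ∈ Finset.range (N + 1), Icc ((k : ℝ) / N) ((k + 1) / N) := by
      intro y hy
      have hyN : 0 ≤ y * N := mul_nonneg hy.1 hN0.le
      refine mem_iUnion₂.2 ⟨⌊y * N⌋₊, ?_, ?_, ?_⟩
      · rw [Finset.mem_range, Nat.lt_succ_iff]
        refine Nat.floor_le_of_le ?_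
        nlinarith [hy.2]
      · rw [div_le_iff₀ hN0]
        exact Nat.floor_le hyN
      · rw [le_div_iff₀ hN0]
        exact (Nat.lt_floor_add_one _).le
    have hone : μ (Icc (0 : ℝ) 1) = 1 := (prob_compl_eq_zero_iff measurableSet_Icc).1 hμ
    obtain ⟨k, -, hk⟩ : ∃ k ∈ Finset.range (N + 1),
        ENNReal.ofReal (1 / (N + 1 : ℝ)) ≤ μ (Icc ((k : ℝ) / N) ((k + 1) / N)) := by
      by_contra hcon
      push Not at hcon
      have h1 : (1 : ENNReal) ≤ ∑ k ∈ Finset.range (N + 1), μ (Icc ((k : ℝ) / N) ((k + 1) / N)) := by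
        rw [← hone]
        exact (measure_mono hcover).trans (measure_biUnion_finset_le _ _)
      have h2 : ∑ k ∈ Finset.range (N + 1), μ (Icc ((k : ℝ) / N) ((k + 1) / N))
          < ∑ k ∈ Finset.range (N + 1), ENNReal.ofReal (1 / (N + 1 : ℝ)) :=
        ENNReal.sum_lt_sum_of_nonempty ⟨0, by simp⟩ hcon
      rw [Finset.sum_const, Finset.card_range, nsmul_eq_mul, ← ENNReal.ofReal_natCast,
        ← ENNReal.ofReal_mul (by positivity)] at h2
      push_cast at h2
      rw [mul_one_div_cancel (by positivity), ENNReal.ofReal_one] at h2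
      exact absurd h1 (not_le.2 h2)
    have hpos : 0 < μ (Icc ((k : ℝ) / N) ((k + 1) / N)) :=
      lt_of_lt_of_le (ENNReal.ofReal_pos.2 (by positivity)) hk
    obtain ⟨x, hx, hxs⟩ := Measure.nonempty_inter_support_of_pos hpos
    have hsub : Icc ((k : ℝ) / N) ((k + 1) / N) ⊆ Metric.closedBall x (1 / N) := by
      intro y hy
      have : ((k : ℝ) + 1) / N = k / N + 1 / N := by ring
      rw [this] at hx hy
      rw [Metric.mem_closedBall, Real.dist_eq, abs_le]
      constructor <;> linarith [hx.1, hx.2, hy.1, hy.2]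
    have h3 : (1 : ℝ) / N < 1 := by
      rw [div_lt_one hN0]
      exact_mod_cast hN
    have h4 := (hk.trans (measure_mono hsub)).trans (hpow.upper x hxs (1 / N) (by positivity) h3)
    have hb₂ := hpow.upper_pos
    rw [ENNReal.ofReal_le_ofReal_iff (by positivity), Real.div_rpow zero_le_one hN0.le,
      Real.one_rpow, mul_one_div, div_le_div_iff₀ (by positivity) (by positivity)] at h4
    have hN1 : (1 : ℝ) ≤ N := by exact_mod_cast (by omega : 1 ≤ N)
    rw [Real.rpow_sub_one hN0.ne', div_le_iff₀ hN0]
    nlinarith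
  have hlim : Filter.Tendsto (fun N : ℕ => (N : ℝ) ^ (β - 1)) Filter.atTop Filter.atTop :=
    (tendsto_rpow_atTop (by linarith)).comp tendsto_natCast_atTop_atTop
  obtain ⟨N, h1, h2⟩ := ((hlim.eventually_gt_atTop (2 * b₂)).and
    (Filter.eventually_ge_atTop 2)).exists
  exact absurd (key N h2) (not_le.2 h1)

end PowerLaw

/-! ### Counting the points of the support close to the lines of a block -/

/-- The number of separated points of the support that are close to a line of a block, when no line
of smaller height is involved. -/
theorem card_le_of_block {μ : Measure ℝ} {β b₁ b₂ : ℝ} (hpow : PowerLaw μ β b₁ b₂)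
    {i j θ cθ c h b ρ y₀ r s T V : ℝ} (hi : 0 < i) (hj : 0 < j) (hij : i + j = 1)
    (hθ : BadWitness i θ cθ) (hc : 0 < c) (hcc : c ≤ cθ) (hh : 0 < h) (hb : 0 < b)
    (hsmall : 48 * c + 24 * ((2 * h / b) ^ i * b ^ 2 * ρ) < 1)
    (hr : 0 < r) (hcs : c / h ≤ s) (hrs : r ≤ s) (hT : 8 ≤ T) (hTs : T * s ≤ ρ) (hρ : 3 * ρ < 1)
    (hV : (48 * (T * s * h / c)) ^ (1 / (i * j)) * (c / h) ≤ V) (hsV : s ≤ V) (hV1 : 7 * V < 1)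
    {ι : Type*} (S : Finset ι) (x y : ι → ℝ) (L : ι → ℤ × ℤ × ℤ)
    (hx : ∀ a ∈ S, x a ∈ μ.support) (hsep : ∀ a ∈ S, ∀ a' ∈ S, a ≠ a' → r < |x a - x a'|)
    (hx₀ : ∀ a ∈ S, |x a - y₀| ≤ ρ) (hy₀ : ∀ a ∈ S, |y a - y₀| ≤ ρ)
    (hxy : ∀ a ∈ S, |x a - y a| ≤ r) (hL : ∀ a ∈ S, InBlock i j h b (L a))
    (hLy : ∀ a ∈ S, |lineForm θ (L a) (y a)| ≤ c / weight i j (L a).1 (L a).2.1)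
    (hlow : ∀ a ∈ S, ∀ L' : ℤ × ℤ × ℤ, Int.gcd L'.1 (Int.gcd L'.2.1 L'.2.2) = 1 → 0 < L'.2.1 →
      height i j L'.1 L'.2.1 < h → ¬ |lineForm θ L' (y a)| ≤ c / weight i j L'.1 L'.2.1) :
    (S.card : ℝ) ≤ (b₂ / b₁) ^ 2 * (99 * ρ / (T * r)) ^ β ∨
      (S.card : ℝ) ≤ b₂ / b₁ * (13 * V / r) ^ β := by
  classical
  have hb₁ := hpow.lower_pos
  have hb₂ := hpow.upper_pos
  have hβ := hpow.exponent_pos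
  have hs : 0 < s := hr.trans_le hrs
  have hord : ∀ a ∈ S, |ordinate θ (L a) - y a| ≤ c / h := fun a ha =>
    (hL a ha).abs_ordinate_sub_le hj hh (hLy a ha)
  by_cases hclose : ∃ a₁ ∈ S, ∃ a₂ ∈ S, L a₁ ≠ L a₂ ∧
      |ordinate θ (L a₂) - ordinate θ (L a₁)| ≤ T * s
  · right
    obtain ⟨a₁, ha₁, a₂, ha₂, hne, hcl⟩ := hclose
    have ht : 1 ≤ T * s * h / c := by
      rw [le_div_iff₀ hc, one_mul]
      rw [div_le_iff₀ hh] at hcs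
      nlinarith [mul_pos hs hh]
    have hV0 : 0 < V := hs.trans_le hsV
    -- One V for each leg: from x to y, from y to the ordinate of its line, and from there to the
    -- common point.
    have hnear : ∀ a ∈ S, |x a - crossY (L a₁) (L a₂) / crossZ (L a₁) (L a₂)| ≤ 3 * V := by
      intro a ha
      have hdc := det_and_cross_of_block (θ := θ) (y₀ := y₀) hi hj hij hc hh hb hsmall (hL a₁ ha₁)
        (hL a₂ ha₂) (hL a ha) ⟨y a₁, hy₀ a₁ ha₁, hLy a₁ ha₁⟩ ⟨y a₂, hy₀ a₂ ha₂, hLy a₂ ha₂⟩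
        ⟨y a, hy₀ a ha, hLy a ha⟩
      have h1 := abs_ordinate_sub_cross_le hi hj hij hθ hc hcc hh hb ht (hL a₁ ha₁) (hL a₂ ha₂)
        (hdc.2 hne) (hLy a₁ ha₁) (hcl.trans_eq (by field_simp)) (hlow a₁ ha₁) (hL a ha) hdc.1
      have h2 := hord a ha
      have h3 := hxy a ha
      rw [abs_le] at h1 h2 h3 ⊢
      constructor <;> linarith
    refine (hpow.card_le S x hx (half_pos hr) (by positivity) (by linarith)
      (fun a ha a' ha' hne' => by linarith [hsep a ha a' ha' hne']) hnear).trans ?_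
    refine mul_le_mul_of_nonneg_left (Real.rpow_le_rpow (by positivity) ?_ hβ.le) (by positivity)
    rw [div_le_div_iff₀ (by positivity) hr]
    nlinarith
  · left
    push Not at hclose
    set 𝓛 := S.image L with h𝓛
    have hfib : ∀ ℓ ∈ 𝓛, ((S.filter fun a => L a = ℓ).card : ℝ) ≤ b₂ / b₁ * (9 * s / r) ^ β := by
      intro ℓ _
      refine (hpow.card_le (S.filter fun a => L a = ℓ) x
        (fun a ha => hx a (Finset.mem_of_mem_filter a ha)) (half_pos hr)
        (d := 2 * s) (z := ordinate θ ℓ) (by positivity) (by nlinarith)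
        (fun a ha a' ha' hne' => ?_) (fun a ha => ?_)).trans ?_
      · linarith [hsep a (Finset.mem_of_mem_filter a ha) a' (Finset.mem_of_mem_filter a' ha') hne']
      · rw [Finset.mem_filter] at ha
        have h2 := hord a ha.1
        have h3 := hxy a ha.1
        rw [← ha.2]
        rw [abs_le] at h2 h3 ⊢
        constructor <;> linarith
      · refine mul_le_mul_of_nonneg_left (Real.rpow_le_rpow (by positivity) ?_ hβ.le) (by positivity)
        rw [div_le_div_iff₀ (by positivity) hr]
        nlinarith
    have hrep : ∀ ℓ ∈ 𝓛, ∃ a ∈ S, L a = ℓ := fun ℓ hℓ => Finset.mem_image.1 hℓ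
    have hne : ∀ ℓ : ℤ × ℤ × ℤ, ∃ u : ℝ, ∀ (_ : ℓ ∈ 𝓛), ∃ a ∈ S, L a = ℓ ∧ u = x a := by
      intro ℓ
      by_cases hℓ : ℓ ∈ 𝓛
      · obtain ⟨a, ha, hal⟩ := hrep ℓ hℓ
        exact ⟨x a, fun _ => ⟨a, ha, hal, rfl⟩⟩
      · exact ⟨0, fun h => absurd h hℓ⟩
    choose u hu using hne
    have hρ0 : 0 < ρ := lt_of_lt_of_le (by positivity) hTs
    -- One support point is kept per line, at distance at most 2s from its ordinate. As T ≥ 8,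
    -- representatives stay more than Ts/2 apart, enough for disjoint balls of radius Ts/5. In the
    -- product with the count per line, s cancels.
    have hlines : (𝓛.card : ℝ) ≤ b₂ / b₁ * (11 * ρ / (T * s)) ^ β := by
      have hTs0 : 0 < T * s := by positivity
      refine (hpow.card_le 𝓛 u (fun ℓ hℓ => ?_) (r := T * s / 5) (d := ρ) (z := y₀) (by positivity)
        (by linarith) (by linarith) (fun ℓ hℓ ℓ' hℓ' hne' => ?_) (fun ℓ hℓ => ?_)).trans ?_
      · obtain ⟨a, ha, -, hua⟩ := hu ℓ hℓ
        exact hua ▸ hx a ha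
      · obtain ⟨a, ha, hal, hua⟩ := hu ℓ hℓ
        obtain ⟨a', ha', hal', hua'⟩ := hu ℓ' hℓ'
        have h1 := hclose a' ha' a ha (by rw [hal, hal']; exact hne'.symm)
        have h2 := hord a ha
        have h3 := hxy a ha
        have h2' := hord a' ha'
        have h3' := hxy a' ha'
        rw [hua, hua']
        rw [abs_le] at h2 h3 h2' h3'
        have h8 : 8 * s ≤ T * s := by gcongr
        rcases lt_abs.1 h1 with h1 | h1
        · exact lt_abs.2 (Or.inl (by linarith))
        · exact lt_abs.2 (Or.inr (by linarith))
      · obtain ⟨a, ha, -, hua⟩ := hu ℓ hℓ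
        exact hua ▸ hx₀ a ha
      · refine mul_le_mul_of_nonneg_left (Real.rpow_le_rpow (by positivity) ?_ hβ.le) (by positivity)
        rw [div_le_div_iff₀ (by positivity) hTs0]
        nlinarith
    rw [Finset.card_eq_sum_card_image L S, Nat.cast_sum]
    calc ∑ ℓ ∈ 𝓛, ((S.filter fun a => L a = ℓ).card : ℝ)
        ≤ ∑ ℓ ∈ 𝓛, b₂ / b₁ * (9 * s / r) ^ β := Finset.sum_le_sum hfib
      _ = 𝓛.card * (b₂ / b₁ * (9 * s / r) ^ β) := by rw [Finset.sum_const, nsmul_eq_mul]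
      _ ≤ (b₂ / b₁ * (11 * ρ / (T * s)) ^ β) * (b₂ / b₁ * (9 * s / r) ^ β) := by gcongr
      _ = (b₂ / b₁) ^ 2 * ((11 * ρ / (T * s)) ^ β * (9 * s / r) ^ β) := by ring
      _ = (b₂ / b₁) ^ 2 * (99 * ρ / (T * r)) ^ β := by
          rw [← Real.mul_rpow (by positivity) (by positivity)]
          congr 2
          field_simp
          norm_num

/-! ### Numerical inequalities -/

/-- Since log₂ x is eventually below x^ε, the solution set is bounded and its supremum is
meaningful. If the inequality failed at R, the intermediate value theorem would give a solution
beyond R, contradicting the supremum. -/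
theorem logb_le_rpow_of_threshold {ε R : ℝ} (hε : 0 < ε) (hR : 1 < R)
    (h : sSup {x : ℝ | 1 < x ∧ x ^ ε = Real.logb 2 x} ≤ R) : Real.logb 2 R ≤ R ^ ε := by
  by_contra hcon
  push Not at hcon
  set S : Set ℝ := {x : ℝ | 1 < x ∧ x ^ ε = Real.logb 2 x} with hS
  have hev : ∀ᶠ x : ℝ in Filter.atTop, Real.logb 2 x < x ^ ε := by
    have h2 : 0 < Real.log 2 / 2 := half_pos (Real.log_pos one_lt_two)
    filter_upwards [(isLittleO_log_rpow_atTop hε).bound h2, Filter.eventually_gt_atTop 1]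
      with x hx hx1
    rw [Real.norm_of_nonneg (Real.log_nonneg hx1.le), Real.norm_of_nonneg (by positivity)] at hx
    rw [Real.logb, div_lt_iff₀ (Real.log_pos one_lt_two)]
    have : 0 < x ^ ε := by positivity
    nlinarith [Real.log_pos one_lt_two]
  obtain ⟨M, hM⟩ := Filter.eventually_atTop.1 hev
  have hbdd : BddAbove S := by
    refine ⟨M, fun x hx => ?_⟩
    by_contra hlt
    push Not at hlt
    exact (hM x hlt.le).ne' hx.2
  have hMR : R ≤ max M R := le_max_right _ _
  have hcont : ContinuousOn (fun x : ℝ => x ^ ε - Real.logb 2 x) (Icc R (max M R)) := by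
    refine ContinuousOn.sub ?_ ?_
    · exact (Real.continuous_rpow_const hε.le).continuousOn
    · exact ContinuousOn.div_const
        (Real.continuousOn_log.mono fun x hx => ne_of_gt (by linarith [hx.1])) _
  obtain ⟨x, hx, hx0⟩ := intermediate_value_Icc hMR hcont
    (show (0 : ℝ) ∈ Icc _ _ from ⟨sub_nonpos.2 hcon.le,
      sub_nonneg.2 (hM (max M R) (le_max_left _ _)).le⟩)
  have hx0' : x ^ ε = Real.logb 2 x := sub_eq_zero.1 hx0
  have hxR : x ≤ R := (le_csSup hbdd ⟨hR.trans_le hx.1, hx0'⟩).trans h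
  have : x = R := le_antisymm hxR hx.1
  rw [this] at hx0'
  linarith

/-- The consequences of `R ≥ max {R₁, R₂}` that are used below. -/
structure LargeBase (β i j b₁ b₂ R : ℝ) : Prop where
  four_le : 4 ≤ R
  logb_le : Real.logb 2 R ≤ R ^ expEps β i j
  ratio_le : 64 * (b₂ / b₁) ^ 2 ≤ R ^ (2 * expEps β i j)

theorem expAlpha_pos {β i j : ℝ} (hβ : 0 < β) (hi : 0 < i) (hj : 0 < j) : 0 < expAlpha β i j := by
  unfold expAlpha; positivity

theorem expEps_pos {β i j : ℝ} (hβ : 0 < β) (hi : 0 < i) (hj : 0 < j) : 0 < expEps β i j := by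
  have := expAlpha_pos hβ hi hj
  unfold expEps; positivity

theorem LargeBase.of_threshold_le {β i j b₁ b₂ R : ℝ} (hβ : 0 < β) (hβ1 : β ≤ 1) (hi : 0 < i)
    (hj : 0 < j) (hb₁ : 0 < b₁) (hb₂ : 0 < b₂)
    (hR : max (threshold1 β i j b₁ b₂) (threshold2 β) ≤ R) : LargeBase β i j b₁ b₂ R := by
  have h2 : threshold2 β ≤ R := (le_max_right _ _).trans hR
  have h1 : threshold1 β i j b₁ b₂ ≤ R := (le_max_left _ _).trans hR
  have h4 : 4 ≤ R := by
    refine le_trans ?_ h2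
    have : (4 : ℝ) = 2 ^ (2 : ℝ) := by norm_num
    rw [threshold2, this]
    refine Real.rpow_le_rpow_of_exponent_le one_le_two ?_
    rw [le_div_iff₀ hβ]; linarith
  have hα := expAlpha_pos hβ hi hj
  have hε := expEps_pos hβ hi hj
  refine ⟨h4, ?_, ?_⟩
  · exact logb_le_rpow_of_threshold hε (by linarith) ((le_max_left _ _).trans h1)
  · have h3 : (64 * b₂ ^ 2 / b₁ ^ 2) ^ (10 / (expAlpha β i j * β ^ 2 * i * j)) ≤ R :=
      ((le_max_left _ _).trans (le_max_right _ _)).trans h1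
    have h5 : 64 * (b₂ / b₁) ^ 2 = 64 * b₂ ^ 2 / b₁ ^ 2 := by rw [div_pow]; ring
    have hX : 0 < 64 * b₂ ^ 2 / b₁ ^ 2 := by positivity
    rw [h5]
    calc 64 * b₂ ^ 2 / b₁ ^ 2
        = ((64 * b₂ ^ 2 / b₁ ^ 2) ^ (10 / (expAlpha β i j * β ^ 2 * i * j)))
            ^ (2 * expEps β i j) := by
          rw [← Real.rpow_mul hX.le]
          have : 10 / (expAlpha β i j * β ^ 2 * i * j) * (2 * expEps β i j) = 1 := by
            unfold expEps; field_simp; norm_num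
          rw [this, Real.rpow_one]
      _ ≤ R ^ (2 * expEps β i j) := by gcongr

theorem mul_le_quarter {i j : ℝ} (hij : i + j = 1) : i * j ≤ 1 / 4 := by
  nlinarith [sq_nonneg (i - j)]

namespace LargeBase

variable {β i j b₁ b₂ R : ℝ}

theorem sixtyfour_le (H : LargeBase β i j b₁ b₂ R) (hb₁ : 0 < b₁) (hb : b₁ ≤ b₂) :
    64 ≤ R ^ (2 * expEps β i j) := by
  refine le_trans ?_ H.ratio_le
  have : 1 ≤ (b₂ / b₁) ^ 2 := one_le_pow₀ ((one_le_div hb₁).2 hb)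
  linarith

theorem eight_le (H : LargeBase β i j b₁ b₂ R) (hb₁ : 0 < b₁) (hb : b₁ ≤ b₂) :
    8 ≤ R ^ expEps β i j := by
  have h := H.sixtyfour_le hb₁ hb
  have hR := H.four_le
  have h0 : 0 < R ^ expEps β i j := Real.rpow_pos_of_pos (by linarith) _
  rw [two_mul, Real.rpow_add (by linarith)] at h
  nlinarith

/-- Absorbs the constant 48^(1/(ij)) of the concurrent case into a small power of R; the identity
behind it is 2ε/(ij) = αβ²/10. -/
theorem rpow_inv_le (H : LargeBase β i j b₁ b₂ R) (hβ : 0 < β) (hβ1 : β ≤ 1) (hi : 0 < i)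
    (hj : 0 < j) (hb₁ : 0 < b₁) (hb : b₁ ≤ b₂) :
    (64 : ℝ) ^ (1 / (i * j)) ≤ R ^ (expAlpha β i j / 10) := by
  have hR := H.four_le
  have hα := expAlpha_pos hβ hi hj
  have hij0 : 0 < i * j := by positivity
  calc (64 : ℝ) ^ (1 / (i * j)) ≤ (R ^ (2 * expEps β i j)) ^ (1 / (i * j)) := by
        gcongr
        exact H.sixtyfour_le hb₁ hb
    _ = R ^ (2 * expEps β i j * (1 / (i * j))) := by rw [← Real.rpow_mul (by linarith)]
    _ ≤ _ := by
        refine Real.rpow_le_rpow_of_exponent_le (by linarith) ?_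
        have : 2 * expEps β i j * (1 / (i * j)) = expAlpha β i j / 10 * β ^ 2 := by
          unfold expEps; field_simp; norm_num
        rw [this]
        refine mul_le_of_le_one_right (by positivity) ?_
        exact pow_le_one₀ hβ.le hβ1

end LargeBase

theorem const1_pos {β i j cθ R : ℝ} (hc : 0 < cθ) (hR : 0 < R) : 0 < const1 β i j cθ R := by
  unfold const1; positivity

theorem levelRadius_eq {c₁ R : ℝ} (n : ℕ) : levelRadius c₁ R n = 1 / 2 * c₁ * R ^ (-(n : ℝ)) := by
  unfold levelRadius
  rw [← Real.rpow_intCast]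
  push_cast
  rfl

/-! ### Counting the intervals removed by a block -/

/-- The condition Ts ≤ ρ of `card_le_of_block`, with p = ij, h = R^(n-z), T = R^((αp/2)(l+1)), s the
larger of c/h and the radius of level n+1, and ρ the radius of level n-l. -/
theorem spacing_mul_radius_le {R α p n l z c₁ : ℝ} (hR : 1 ≤ R) (hα0 : 0 < α) (hα : α ≤ 1 / 16)
    (hp : p ≤ 1 / 4) (h2 : 2 ≤ R ^ (α / 10)) (hl : 0 ≤ l) (hz : z ≤ 1)
    (hc₁ : 0 < c₁) :
    R ^ (α * p / 2 * (l + 1)) * max (c₁ * R ^ (-1 - α - n + z)) (1 / 2 * c₁ * R ^ (-(n + 1)))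
      ≤ 1 / 2 * c₁ * R ^ (l - n) := by
  have hR0 : 0 < R := by linarith
  have hαp : α * p / 2 ≤ α / 8 := by nlinarith
  have hlα : α * p / 2 * (l + 1) ≤ α / 8 * (l + 1) := by gcongr
  have hlα' : α * l ≤ 1 * l := by gcongr; linarith
  rw [mul_max_of_nonneg _ _ (by positivity)]
  refine max_le ?_ ?_
  · have h1 : R ^ (α * p / 2 * (l + 1)) * R ^ (-1 - α - n + z) * 2 ≤ R ^ (l - n) := by
      calc R ^ (α * p / 2 * (l + 1)) * R ^ (-1 - α - n + z) * 2
          ≤ R ^ (α * p / 2 * (l + 1)) * R ^ (-1 - α - n + z) * R ^ (α / 10) := by gcongr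
        _ = R ^ (α * p / 2 * (l + 1) + (-1 - α - n + z) + α / 10) := by
            rw [← Real.rpow_add hR0, ← Real.rpow_add hR0]
        _ ≤ _ := Real.rpow_le_rpow_of_exponent_le hR (by linarith)
    calc R ^ (α * p / 2 * (l + 1)) * (c₁ * R ^ (-1 - α - n + z))
        = 1 / 2 * c₁ * (R ^ (α * p / 2 * (l + 1)) * R ^ (-1 - α - n + z) * 2) := by ring
      _ ≤ _ := by gcongr
  · calc R ^ (α * p / 2 * (l + 1)) * (1 / 2 * c₁ * R ^ (-(n + 1)))
        = 1 / 2 * c₁ * R ^ (α * p / 2 * (l + 1) + -(n + 1)) := by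
          rw [Real.rpow_add hR0]; ring
      _ ≤ _ := by
          gcongr 1 / 2 * c₁ * ?_
          exact Real.rpow_le_rpow_of_exponent_le hR (by linarith)

/-- The exponent αp/2 in T becomes only α/2 after taking the power 1/p. When the radius of level n+1
exceeds c/h, the extra loss is (α - z)/p = β/4 - z/p, harmless because α = βp/4 with β ≤ 1. -/
theorem concurrency_radius_le {R α β p n l z c₁ : ℝ} (hR : 1 ≤ R) (hβ : β ≤ 1)
    (hαβ : α = β * p / 4) (hα0 : 0 < α) (hp0 : 0 < p) (hp : p ≤ 1 / 4) (hz0 : 0 ≤ z)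
    (hz : z ≤ 1) (hc₁ : 0 < c₁) :
    (48 * (R ^ (α * p / 2 * (l + 1)) *
        max (c₁ * R ^ (-1 - α - n + z)) (1 / 2 * c₁ * R ^ (-(n + 1))) /
          (c₁ * R ^ (-1 - α - n + z)))) ^ (1 / p) * (c₁ * R ^ (-1 - α - n + z))
      ≤ 48 ^ (1 / p) * (c₁ * R ^ (α / 2 * (l + 1) - α - n)) := by
  have hR0 : 0 < R := by linarith
  have hd0 : 0 < c₁ * R ^ (-1 - α - n + z) := by positivity
  obtain ⟨w, hw1, hw2⟩ : ∃ w : ℝ, R ^ (α * p / 2 * (l + 1)) *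
      max (c₁ * R ^ (-1 - α - n + z)) (1 / 2 * c₁ * R ^ (-(n + 1))) /
          (c₁ * R ^ (-1 - α - n + z)) ≤ R ^ w ∧
        w / p + (-1 - α - n + z) ≤ α / 2 * (l + 1) - α - n := by
    rcases max_cases (c₁ * R ^ (-1 - α - n + z)) (1 / 2 * c₁ * R ^ (-(n + 1)))
      with ⟨hmax, -⟩ | ⟨hmax, -⟩
    · refine ⟨α * p / 2 * (l + 1), le_of_eq ?_, ?_⟩
      · rw [hmax, mul_div_assoc, div_self hd0.ne', mul_one]
      · have : α * p / 2 * (l + 1) / p = α / 2 * (l + 1) := by field_simp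
        rw [this]; linarith
    · refine ⟨α * p / 2 * (l + 1) + (α - z), ?_, ?_⟩
      · rw [hmax, Real.rpow_add hR0 (α * p / 2 * (l + 1)), mul_div_assoc]
        refine mul_le_mul_of_nonneg_left ?_ (by positivity)
        rw [div_le_iff₀ hd0]
        have : R ^ (α - z) * (c₁ * R ^ (-1 - α - n + z)) = c₁ * R ^ (-(n + 1)) := by
          rw [mul_left_comm, ← Real.rpow_add hR0]; congr 2; ring
        rw [this]
        have : 0 < c₁ * R ^ (-(n + 1)) := by positivity
        linarith
      · have h1 : (α * p / 2 * (l + 1) + (α - z)) / p = α / 2 * (l + 1) + β / 4 - z / p := by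
          rw [hαβ]; field_simp; ring
        have h2 : z ≤ z / p := by
          rw [le_div_iff₀ hp0]; nlinarith
        rw [h1]; linarith
  calc _ ≤ (48 * R ^ w) ^ (1 / p) * (c₁ * R ^ (-1 - α - n + z)) := by gcongr
    _ = 48 ^ (1 / p) * (c₁ * R ^ (w / p + (-1 - α - n + z))) := by
        rw [Real.mul_rpow (by norm_num) (by positivity), ← Real.rpow_mul hR0.le,
          Real.rpow_add hR0 (w / p), mul_one_div]
        ring
    _ ≤ _ := by
        refine mul_le_mul_of_nonneg_left (mul_le_mul_of_nonneg_left ?_ hc₁.le) (by positivity)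
        exact Real.rpow_le_rpow_of_exponent_le hR hw2

theorem le_concurrency_radius {p s T d : ℝ} (hp0 : 0 < p) (hp : p ≤ 1) (hT : 1 ≤ T) (hd : 0 < d)
    (hs : d ≤ s) : s ≤ (48 * (T * s / d)) ^ (1 / p) * d := by
  have h2 : 1 ≤ s / d := (one_le_div hd).2 hs
  have h3 : s / d ≤ 48 * (T * s / d) := by
    rw [mul_div_assoc]
    nlinarith
  calc s = s / d * d := by field_simp
    _ ≤ (48 * (T * s / d)) ^ (1 : ℝ) * d := by rw [Real.rpow_one]; gcongr
    _ ≤ _ := by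
        refine mul_le_mul_of_nonneg_right ?_ hd.le
        refine Real.rpow_le_rpow_of_exponent_le (h2.trans h3) ?_
        rw [le_div_iff₀ hp0]; linarith

/-- This is why blocks of index l are paired with intervals of level n-l: as 2 - i = 1 + j, the
powers of R cancel exactly, and the determinants are controlled by c₁ alone. -/
theorem block_area_le {i j R h b n l c₁ : ℝ} (hi1 : i ≤ 1) (hi : 0 < i)
    (hij : i + j = 1) (hR : 0 < R) (hh : 0 < h) (hhR : h ≤ R ^ n) (hb : 0 < b)
    (hbl : b ^ (1 + j) ≤ R ^ (n * j - l)) (hc₁ : 0 < c₁) :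
    (2 * h / b) ^ i * b ^ 2 * (1 / 2 * c₁ * R ^ (l - n)) ≤ c₁ := by
  have h1 : (2 * h / b) ^ i * b ^ 2 = (2 * h) ^ i * b ^ (1 + j) := by
    rw [Real.div_rpow (by positivity) hb.le, div_mul_eq_mul_div, mul_div_assoc]
    congr 1
    rw [div_eq_iff (by positivity), ← Real.rpow_add hb, ← Real.rpow_natCast]
    congr 1; push_cast; linarith
  have h2 : (2 * h) ^ i ≤ 2 * R ^ (n * i) := by
    rw [Real.mul_rpow (by norm_num) hh.le, Real.rpow_mul hR.le]
    gcongr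
    calc (2 : ℝ) ^ i ≤ 2 ^ (1 : ℝ) := Real.rpow_le_rpow_of_exponent_le one_le_two hi1
      _ = 2 := Real.rpow_one 2
  rw [h1]
  calc (2 * h) ^ i * b ^ (1 + j) * (1 / 2 * c₁ * R ^ (l - n))
      ≤ (2 * R ^ (n * i)) * R ^ (n * j - l) * (1 / 2 * c₁ * R ^ (l - n)) := by gcongr
    _ = c₁ * R ^ (n * i + (n * j - l) + (l - n)) := by
        rw [Real.rpow_add hR, Real.rpow_add hR]; ring
    _ = c₁ := by
        have : n * i + (n * j - l) + (l - n) = 0 := by linear_combination n * hij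
        rw [this, Real.rpow_zero, mul_one]

theorem const1_le {β i j cθ R : ℝ} (hβ : β ≤ 1) (hi : 0 < i) (hj : 0 < j)
    (hj1 : j ≤ 1) (hR : 1 ≤ R) (h64 : 64 ≤ R ^ expAlpha β i j) :
    const1 β i j cθ R ≤ 1 / 256 := by
  have h1 : const1 β i j cθ R ≤ 1 / 4 * R ^ (-expAlpha β i j) := by
    refine (min_le_right _ _).trans ?_
    refine mul_le_mul_of_nonneg_left ?_ (by norm_num)
    refine Real.rpow_le_rpow_of_exponent_le hR (neg_le_neg ?_)
    have hβj : β * (j * j) ≤ 1 * (1 * 1) := by gcongr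
    rw [le_div_iff₀ hj, expAlpha]
    have : β * i * j / 4 * j = i * (β * (j * j) / 4) := by ring
    rw [this]
    nlinarith
  refine h1.trans ?_
  rw [Real.rpow_neg (by linarith)]
  have : (R ^ expAlpha β i j)⁻¹ ≤ 64⁻¹ := by gcongr
  linarith

theorem const0_eq (β i j cθ : ℝ) {R : ℝ} (hR : 0 ≤ R) :
    const0 β i j cθ R = const1 β i j cθ R * R ^ (-(1 + expAlpha β i j)) := by
  rw [const0, Real.rpow_neg hR, div_eq_mul_inv]

theorem const0_le (β i j cθ : ℝ) {R : ℝ} (hR : 0 < R) : const0 β i j cθ R ≤ cθ := by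
  unfold const0
  rw [div_le_iff₀ (by positivity)]
  exact min_le_left _ _

/-- The ratio of the radii of levels n-l and n+1 is R^(l+1); dividing by T saves the power αp/2 of
it, which after raising to β covers 10ε. -/
theorem separated_bound {R α β ε p n l c₁ : ℝ} (hR : 1 ≤ R) (hβ : β ≤ 1)
    (hε : 10 * ε ≤ β * (α * p / 2)) (hl : 0 ≤ l) (hc₁ : 0 < c₁) :
    (99 * (1 / 2 * c₁ * R ^ (l - n)) /
        (R ^ (α * p / 2 * (l + 1)) * (1 / 2 * c₁ * R ^ (-(n + 1))))) ^ β
      ≤ 99 * R ^ ((β - 10 * ε) * (l + 1)) := by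
  have hR0 : 0 < R := by linarith
  have h1 : 99 * (1 / 2 * c₁ * R ^ (l - n)) /
        (R ^ (α * p / 2 * (l + 1)) * (1 / 2 * c₁ * R ^ (-(n + 1))))
      = 99 * R ^ ((1 - α * p / 2) * (l + 1)) := by
    rw [div_eq_iff (by positivity)]
    have : R ^ (l - n)
        = R ^ ((1 - α * p / 2) * (l + 1)) * R ^ (α * p / 2 * (l + 1)) * R ^ (-(n + 1)) := by
      rw [← Real.rpow_add hR0, ← Real.rpow_add hR0]; congr 1; ring
    rw [this]; ring
  rw [h1, Real.mul_rpow (by norm_num) (by positivity), ← Real.rpow_mul hR0.le]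
  refine mul_le_mul ?_ ?_ (by positivity) (by norm_num)
  · calc (99 : ℝ) ^ β ≤ 99 ^ (1 : ℝ) := Real.rpow_le_rpow_of_exponent_le (by norm_num) hβ
      _ = 99 := Real.rpow_one _
  · refine Real.rpow_le_rpow_of_exponent_le hR ?_
    have : (1 - α * p / 2) * (l + 1) * β = (β - β * (α * p / 2)) * (l + 1) := by ring
    rw [this]
    gcongr

/-- The saving R^(-α) from c = c₁ R^(-1-α) is what beats the losses α/2 and α/5 at l = 0; for larger
l the loss grows only like αl/2. -/
theorem concurrent_bound {R α β ε n l c₁ V : ℝ} (hR : 1 ≤ R) (hβ0 : 0 < β) (hα0 : 0 < α)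
    (hα : α ≤ 1 / 16) (hε : 10 * ε ≤ β * (α / 8)) (hl : 0 ≤ l) (hc₁ : 0 < c₁) (hV0 : 0 < V)
    (hV : 26 * V ≤ c₁ * R ^ (α / 5 + (α / 2 * (l + 1) - α - n))) :
    (13 * V / (1 / 2 * c₁ * R ^ (-(n + 1)))) ^ β ≤ R ^ ((β - 10 * ε) * (l + 1)) := by
  have hR0 : 0 < R := by linarith
  have h1 : 13 * V / (1 / 2 * c₁ * R ^ (-(n + 1))) ≤ R ^ (α / 5 + (α / 2 * (l + 1) - α) + 1) := by
    rw [div_le_iff₀ (by positivity)]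
    have : R ^ (α / 5 + (α / 2 * (l + 1) - α - n))
        = R ^ (α / 5 + (α / 2 * (l + 1) - α) + 1) * R ^ (-(n + 1)) := by
      rw [← Real.rpow_add hR0]; congr 1; ring
    rw [this] at hV
    linarith
  calc (13 * V / (1 / 2 * c₁ * R ^ (-(n + 1)))) ^ β
      ≤ (R ^ (α / 5 + (α / 2 * (l + 1) - α) + 1)) ^ β := by gcongr
    _ = R ^ ((α / 5 + (α / 2 * (l + 1) - α) + 1) * β) := by rw [← Real.rpow_mul hR0.le]
    _ ≤ _ := by
      refine Real.rpow_le_rpow_of_exponent_le hR ?_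
      have h3 : (α / 5 + (α / 2 * (l + 1) - α) + 1) ≤ (1 - α / 8) * (l + 1) := by nlinarith
      calc (α / 5 + (α / 2 * (l + 1) - α) + 1) * β ≤ (1 - α / 8) * (l + 1) * β := by gcongr
        _ = (β - β * (α / 8)) * (l + 1) := by ring
        _ ≤ _ := by gcongr

set_option maxHeartbeats 1000000 in
/-- The number of intervals of level `n + 1`, inside an interval of level `n - l`, that are removed
by a block of lines and by no line of smaller height. -/
theorem card_le_of_level {μ : Measure ℝ} {β b₁ b₂ : ℝ} (hpow : PowerLaw μ β b₁ b₂) (hβ1 : β ≤ 1)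
    (hb₁₂ : b₁ ≤ b₂) {i j θ cθ R h b y₀ : ℝ} {n l : ℕ} (hi : 0 < i) (hj : 0 < j)
    (hij : i + j = 1) (hθ : BadWitness i θ cθ) (hR : LargeBase β i j b₁ b₂ R) (hl : l ≤ n)
    (hh₁ : R ^ ((n : ℝ) - 1) ≤ h) (hh₂ : h ≤ R ^ (n : ℝ)) (hb : 0 < b)
    (hbl : b ^ (1 + j) ≤ R ^ (n * j - l : ℝ)) {ι : Type*} (S : Finset ι) (x y : ι → ℝ)
    (L : ι → ℤ × ℤ × ℤ) (hx : ∀ a ∈ S, x a ∈ μ.support)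
    (hsep : ∀ a ∈ S, ∀ a' ∈ S, a ≠ a' →
      levelRadius (const1 β i j cθ R) R (n + 1) < |x a - x a'|)
    (hx₀ : ∀ a ∈ S, |x a - y₀| ≤ levelRadius (const1 β i j cθ R) R (n - l))
    (hy₀ : ∀ a ∈ S, |y a - y₀| ≤ levelRadius (const1 β i j cθ R) R (n - l))
    (hxy : ∀ a ∈ S, |x a - y a| ≤ levelRadius (const1 β i j cθ R) R (n + 1))
    (hL : ∀ a ∈ S, InBlock i j h b (L a))
    (hLy : ∀ a ∈ S, |lineForm θ (L a) (y a)| ≤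
      const0 β i j cθ R / weight i j (L a).1 (L a).2.1)
    (hlow : ∀ a ∈ S, ∀ L' : ℤ × ℤ × ℤ, Int.gcd L'.1 (Int.gcd L'.2.1 L'.2.2) = 1 → 0 < L'.2.1 →
      height i j L'.1 L'.2.1 < h →
        ¬ |lineForm θ L' (y a)| ≤ const0 β i j cθ R / weight i j L'.1 L'.2.1) :
    (S.card : ℝ) ≤ 99 * (b₂ / b₁) ^ 2 * R ^ ((β - 10 * expEps β i j) * (l + 1)) := by
  have hβ := hpow.exponent_pos
  have hb₁ := hpow.lower_pos
  have hb₂ := hpow.upper_pos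
  have hR4 := hR.four_le
  have hR0 : 0 < R := by linarith
  have hR1 : 1 ≤ R := by linarith
  have hmono : ∀ {u v : ℝ}, u ≤ v → R ^ u ≤ R ^ v := fun huv =>
    Real.rpow_le_rpow_of_exponent_le hR1 huv
  have hij0 : 0 < i * j := by positivity
  have hij4 := mul_le_quarter hij
  have hα := expAlpha_pos hβ hi hj
  have hK := hR.rpow_inv_le hβ hβ1 hi hj hb₁ hb₁₂
  have h64 := hR.sixtyfour_le hb₁ hb₁₂
  have hαdef : expAlpha β i j = β * (i * j) / 4 := by unfold expAlpha; ring
  have hεdef : expEps β i j = expAlpha β i j * β ^ 2 * (i * j) / 20 := by unfold expEps; ring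
  have hα16 : expAlpha β i j ≤ 1 / 16 := by rw [hαdef]; nlinarith
  have hc₁ : 0 < const1 β i j cθ R := const1_pos hθ.1 hR0
  have hK64 : (64 : ℝ) ≤ 64 ^ (1 / (i * j)) := by
    have : (1 : ℝ) ≤ 1 / (i * j) := by rw [le_div_iff₀ hij0]; linarith
    calc (64 : ℝ) = 64 ^ (1 : ℝ) := (Real.rpow_one _).symm
      _ ≤ _ := Real.rpow_le_rpow_of_exponent_le (by norm_num) this
  have hRα10 : 64 ≤ R ^ (expAlpha β i j / 10) := hK64.trans hK
  have hc₁small : const1 β i j cθ R ≤ 1 / 256 :=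
    const1_le hβ1 hi hj (by linarith) hR1 (hRα10.trans (hmono (by linarith)))
  have hcdef := const0_eq β i j cθ hR0.le
  have hccθ := const0_le β i j cθ hR0
  have hrdef : levelRadius (const1 β i j cθ R) R (n + 1)
      = 1 / 2 * const1 β i j cθ R * R ^ (-(n + 1 : ℝ)) := by
    rw [levelRadius_eq]; push_cast; rfl
  have hρdef : levelRadius (const1 β i j cθ R) R (n - l)
      = 1 / 2 * const1 β i j cθ R * R ^ (l - n : ℝ) := by
    rw [levelRadius_eq, Nat.cast_sub hl, neg_sub]
  rw [hrdef] at hsep hxy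
  rw [hρdef] at hx₀ hy₀
  generalize const0 β i j cθ R = c at *
  generalize const1 β i j cθ R = c₁ at *
  generalize expAlpha β i j = α at *
  generalize expEps β i j = ε at *
  have hln : (l : ℝ) ≤ n := by exact_mod_cast hl
  have hl0 : (0 : ℝ) ≤ l := Nat.cast_nonneg l
  have hh0 : 0 < h := lt_of_lt_of_le (by positivity) hh₁
  -- Writing h as a power of R turns the remaining size comparisons into linear inequalities between
  -- exponents.
  obtain ⟨z, hz0, hz1, hz⟩ : ∃ z : ℝ, 0 ≤ z ∧ z ≤ 1 ∧ h = R ^ (n - z : ℝ) := by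
    have hlog : R ^ Real.logb R h = h := Real.rpow_logb hR0 (by linarith) hh0
    refine ⟨n - Real.logb R h, ?_, ?_, by rw [sub_sub_cancel, hlog]⟩
    · rw [← hlog, Real.rpow_le_rpow_left_iff (by linarith)] at hh₂
      linarith
    · rw [← hlog, Real.rpow_le_rpow_left_iff (by linarith)] at hh₁
      linarith
  have hc : 0 < c := by rw [hcdef]; positivity
  have hcc₁ : c ≤ c₁ := by
    rw [hcdef]
    refine mul_le_of_le_one_right hc₁.le ?_
    exact Real.rpow_le_one_of_one_le_of_nonpos hR1 (by linarith)
  have hch : c / h = c₁ * R ^ (-1 - α - n + z) := by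
    rw [hcdef, hz, mul_div_assoc, ← Real.rpow_sub hR0]
    congr 2; ring
  have hβ2 : β ^ 2 ≤ 1 := pow_le_one₀ hβ.le hβ1
  have hβ2' : β ^ 2 ≤ β * 1 := by rw [sq]; gcongr
  have hε10 : 10 * ε ≤ β * (α * (i * j) / 2) := by
    have : α * (i * j) * β ^ 2 ≤ α * (i * j) * (β * 1) := by gcongr
    linarith
  have hαp : α * (i * j) ≤ α * (1 / 4) := by gcongr
  have hε8 : 10 * ε ≤ β * (α / 8) :=
    hε10.trans (mul_le_mul_of_nonneg_left (by linarith) hβ.le)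
  have hT64 : 64 ≤ R ^ (α * (i * j) / 2 * (l + 1)) := by
    refine h64.trans (hmono ?_)
    have : α * (i * j) * β ^ 2 ≤ α * (i * j) * 1 := by gcongr
    have h1 : 2 * ε ≤ α * (i * j) / 2 * 1 := by
      have : 0 < α * (i * j) := by positivity
      linarith
    refine h1.trans ?_
    gcongr
    linarith
  have hTs := spacing_mul_radius_le (n := n) hR1 hα hα16 hij4 (by linarith) hl0 hz1 hc₁
  have hVle := concurrency_radius_le (n := n) (l := l) hR1 hβ1 hαdef hα hij0 hij4 hz0 hz1 hc₁
  have hr : 0 < 1 / 2 * c₁ * R ^ (-(n + 1 : ℝ)) := by positivity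
  have hsV := le_concurrency_radius (s := max (c / h) (1 / 2 * c₁ * R ^ (-(n + 1 : ℝ)))) hij0
    (by linarith) (by linarith : 1 ≤ R ^ (α * (i * j) / 2 * (l + 1))) (div_pos hc hh0)
    (le_max_left _ _)
  rw [← hch] at hTs hVle
  have hs0 : 0 < max (c / h) (1 / 2 * c₁ * R ^ (-(n + 1 : ℝ))) := lt_max_of_lt_right hr
  have hK2 : 26 * (48 : ℝ) ^ (1 / (i * j)) ≤ R ^ (α / 5) := by
    calc 26 * (48 : ℝ) ^ (1 / (i * j)) ≤ R ^ (α / 10) * R ^ (α / 10) := by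
          refine mul_le_mul (by linarith) (le_trans ?_ hK) (by positivity) (by positivity)
          gcongr
          norm_num
      _ = R ^ (α / 5) := by rw [← Real.rpow_add hR0]; congr 1; ring
  have hρ1 : 3 * (1 / 2 * c₁ * R ^ (l - n : ℝ)) < 1 := by
    have h1 : R ^ (l - n : ℝ) ≤ 1 := Real.rpow_le_one_of_one_le_of_nonpos hR1 (by linarith)
    have : 1 / 2 * c₁ * R ^ (l - n : ℝ) ≤ 1 / 2 * (1 / 256) * 1 := by gcongr
    linarith
  have hsmall : 48 * c + 24 * ((2 * h / b) ^ i * b ^ 2 * (1 / 2 * c₁ * R ^ (l - n : ℝ))) < 1 := by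
    have := block_area_le (by linarith) hi hij hR0 hh0 hh₂ hb hbl hc₁
    linarith
  have hassoc : ∀ u v : ℝ, u * v * h / c = u * v / (c / h) := fun u v => by field_simp
  generalize hVdef : (48 * (R ^ (α * (i * j) / 2 * (l + 1)) *
    max (c / h) (1 / 2 * c₁ * R ^ (-(n + 1 : ℝ))) / (c / h))) ^ (1 / (i * j)) * (c / h) = V
    at hVle hsV
  have hV0 : 0 < V := hs0.trans_le hsV
  have hV26 : 26 * V ≤ c₁ * R ^ (α / 5 + (α / 2 * (l + 1) - α - n)) := by
    rw [Real.rpow_add hR0]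
    calc 26 * V ≤ 26 * (48 ^ (1 / (i * j)) * (c₁ * R ^ (α / 2 * (l + 1) - α - n))) := by gcongr
      _ = (26 * 48 ^ (1 / (i * j))) * (c₁ * R ^ (α / 2 * (l + 1) - α - n)) := by ring
      _ ≤ R ^ (α / 5) * (c₁ * R ^ (α / 2 * (l + 1) - α - n)) := by gcongr
      _ = _ := by ring
  have hV1 : 7 * V < 1 := by
    have hαl : α * l ≤ 1 * l := by gcongr; linarith
    have h1 : R ^ (α / 5 + (α / 2 * (l + 1) - α - n)) ≤ 1 :=
      Real.rpow_le_one_of_one_le_of_nonpos hR1 (by linarith)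
    have h2 : 26 * V ≤ 1 / 256 * 1 := hV26.trans (by gcongr)
    linarith
  have hq1 : 1 ≤ b₂ / b₁ := (one_le_div hb₁).2 hb₁₂
  have hP : 0 < R ^ ((β - 10 * ε) * (l + 1)) := by positivity
  rcases card_le_of_block hpow hi hj hij hθ hc hccθ hh0 hb hsmall hr (le_max_left _ _)
    (le_max_right _ _) (by linarith : 8 ≤ R ^ (α * (i * j) / 2 * (l + 1))) hTs hρ1
    (by rw [hassoc]; exact hVdef.le) hsV hV1 S x y L hx hsep hx₀ hy₀ hxy hL hLy hlow
    with hcase | hcase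
  · have h2 := separated_bound (n := n) hR1 hβ1 hε10 hl0 hc₁
    calc (S.card : ℝ) ≤ _ := hcase
      _ ≤ (b₂ / b₁) ^ 2 * (99 * R ^ ((β - 10 * ε) * (l + 1))) := by gcongr
      _ = _ := by ring
  · have h2 := concurrent_bound hR1 hβ hα hα16 hε8 hl0 hc₁ hV0 hV26
    calc (S.card : ℝ) ≤ _ := hcase
      _ ≤ b₂ / b₁ * R ^ ((β - 10 * ε) * (l + 1)) := by gcongr
      _ ≤ 99 * (b₂ / b₁) ^ 2 * R ^ ((β - 10 * ε) * (l + 1)) := by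
          have := mul_le_mul_of_nonneg_left hq1 (zero_le_one.trans hq1)
          gcongr
          linarith

/-! ### The interval families -/

theorem levelRadius_pos {c₁ R : ℝ} (hc₁ : 0 < c₁) (hR : 0 < R) (n : ℕ) : 0 < levelRadius c₁ R n := by
  unfold levelRadius; positivity

theorem levelRadius_succ {c₁ R : ℝ} (hR : 0 < R) (n : ℕ) :
    levelRadius c₁ R (n + 1) = levelRadius c₁ R n * R⁻¹ := by
  unfold levelRadius
  rw [mul_assoc _ _ R⁻¹, ← zpow_sub_one₀ hR.ne']
  congr 2; push_cast; ring

namespace IsChoice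

variable {μ : Measure ℝ} {α c₁ R : ℝ} {𝓢₀ : Set (Set ℝ)} {sel : ℕ → Set ℝ → Set (Set ℝ)}

theorem exists_centre (H : IsChoice μ α c₁ R 𝓢₀ sel) (n : ℕ) {I : Set ℝ}
    (hI : I ∈ familyI 𝓢₀ sel n) :
    ∃ y ∈ μ.support, I = Metric.closedBall y (levelRadius c₁ R n) := by
  cases n with
  | zero => exact H.zero.subset hI
  | succ n =>
    obtain ⟨I', hI', hI⟩ := mem_iUnion₂.1 hI
    obtain ⟨y, hy, rfl⟩ := (H.succ n I' hI').subset hI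
    exact ⟨y, hy.1, rfl⟩

theorem nonempty (H : IsChoice μ α c₁ R 𝓢₀ sel) (hc₁ : 0 < c₁) (hR : 0 < R) {n : ℕ} {I : Set ℝ}
    (hI : I ∈ familyI 𝓢₀ sel n) : I.Nonempty := by
  obtain ⟨y, -, rfl⟩ := H.exists_centre n hI
  exact Metric.nonempty_closedBall.2 (levelRadius_pos hc₁ hR n).le

/-- Shrinking by 1 - R^(-α) leaves a margin of R^(-α) times the radius around the centres, and the
new radius is only R^(-1) times the old one. -/
theorem subset_of_mem_sel (H : IsChoice μ α c₁ R 𝓢₀ sel) (hc₁ : 0 < c₁) (hR : 1 ≤ R) (hα : α ≤ 1)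
    {n : ℕ} {I I' : Set ℝ} (hI' : I' ∈ familyI 𝓢₀ sel n) (hI : I ∈ sel n I') : I ⊆ I' := by
  have hR0 : 0 < R := by linarith
  obtain ⟨y, hy, rfl⟩ := (H.succ n I' hI').subset hI
  obtain ⟨y', -, rfl⟩ := H.exists_centre n hI'
  have hr := levelRadius_pos hc₁ hR0 n
  have h1 := hy.2
  rw [dilate_closedBall _ _ _ hr.le, Metric.mem_closedBall] at h1
  refine Metric.closedBall_subset_closedBall' ?_
  rw [levelRadius_succ hR0]
  have h2 : R⁻¹ ≤ R ^ (-α) := by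
    rw [← Real.rpow_neg_one]
    exact Real.rpow_le_rpow_of_exponent_le hR (by linarith)
  have h3 : levelRadius c₁ R n * R⁻¹ ≤ levelRadius c₁ R n * R ^ (-α) := by gcongr
  linarith

theorem disjoint_of_ne (H : IsChoice μ α c₁ R 𝓢₀ sel) (hc₁ : 0 < c₁) (hR : 1 ≤ R) (hα : α ≤ 1)
    {n : ℕ} {I₁ I₂ : Set ℝ} (h₁ : I₁ ∈ familyI 𝓢₀ sel n) (h₂ : I₂ ∈ familyI 𝓢₀ sel n)
    (hne : I₁ ≠ I₂) : Disjoint I₁ I₂ := by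
  induction n generalizing I₁ I₂ with
  | zero => exact H.zero.disjoint I₁ h₁ I₂ h₂ hne
  | succ n ih =>
    obtain ⟨I₁', hI₁', hI₁⟩ := mem_iUnion₂.1 h₁
    obtain ⟨I₂', hI₂', hI₂⟩ := mem_iUnion₂.1 h₂
    by_cases heq : I₁' = I₂'
    · subst heq
      exact (H.succ n I₁' hI₁').disjoint I₁ hI₁ I₂ hI₂ hne
    · exact (ih hI₁' hI₂' heq).mono (H.subset_of_mem_sel hc₁ hR hα hI₁' hI₁)
        (H.subset_of_mem_sel hc₁ hR hα hI₂' hI₂)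

theorem eq_of_subset (H : IsChoice μ α c₁ R 𝓢₀ sel) (hc₁ : 0 < c₁) (hR : 1 ≤ R) (hα : α ≤ 1)
    {m n : ℕ} {I J₁ J₂ : Set ℝ} (hI : I ∈ familyI 𝓢₀ sel m) (h₁ : J₁ ∈ familyI 𝓢₀ sel n)
    (h₂ : J₂ ∈ familyI 𝓢₀ sel n) (hs₁ : I ⊆ J₁) (hs₂ : I ⊆ J₂) : J₁ = J₂ := by
  by_contra hne
  obtain ⟨x, hx⟩ := H.nonempty hc₁ (by linarith) hI
  exact disjoint_left.1 (H.disjoint_of_ne hc₁ hR hα h₁ h₂ hne) (hs₁ hx) (hs₂ hx)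

end IsChoice

theorem familyJ_subset_familyI (i j θ c R : ℝ) (𝓢₀ : Set (Set ℝ))
    (sel : ℕ → Set ℝ → Set (Set ℝ)) (n : ℕ) :
    familyJ i j θ c R 𝓢₀ sel n ⊆ familyI 𝓢₀ sel n := by
  induction n with
  | zero => exact subset_rfl
  | succ n ih =>
    rintro I ⟨⟨J, hJ, hI⟩, -⟩
    exact mem_iUnion₂.2 ⟨J, ih hJ, hI⟩

/-! ### Survivors and losses in a tree -/

/-- The data of a tree-like family inside the families `ℐ_n`. -/
structure TreeInFamily (μ : Measure ℝ) (α c₁ R : ℝ) (𝓢₀ : Set (Set ℝ))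
    (sel : ℕ → Set ℝ → Set (Set ℝ)) (𝒯 : ℕ → Set (Set ℝ)) (r : ℕ) : Prop where
  choice : IsChoice μ α c₁ R 𝓢₀ sel
  const_pos : 0 < c₁
  one_le : 1 ≤ R
  le_one : α ≤ 1
  parent : ∀ n, ∀ I ∈ 𝒯 (n + 1), ∃ J ∈ 𝒯 n, I ⊆ J
  sub : ∀ n, 𝒯 n ⊆ familyI 𝓢₀ sel n
  regular : Regular 𝒯 r
  finite_root : (𝒯 0).Finite

namespace TreeInFamily

variable {μ : Measure ℝ} {α c₁ R : ℝ} {𝓢₀ : Set (Set ℝ)} {sel : ℕ → Set ℝ → Set (Set ℝ)}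
  {𝒯 : ℕ → Set (Set ℝ)} {r : ℕ} {i j θ c : ℝ}

theorem eq_of_subset (H : TreeInFamily μ α c₁ R 𝓢₀ sel 𝒯 r) {m n : ℕ} {I J₁ J₂ : Set ℝ}
    (hI : I ∈ familyI 𝓢₀ sel m) (h₁ : J₁ ∈ familyI 𝓢₀ sel n) (h₂ : J₂ ∈ familyI 𝓢₀ sel n)
    (hs₁ : I ⊆ J₁) (hs₂ : I ⊆ J₂) : J₁ = J₂ :=
  H.choice.eq_of_subset H.const_pos H.one_le H.le_one hI h₁ h₂ hs₁ hs₂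

theorem finite_inside (H : TreeInFamily μ α c₁ R 𝓢₀ sel 𝒯 r) {n : ℕ} {J : Set ℝ} (hJ : J ∈ 𝒯 n) :
    (inside 𝒯 (n + 1) J).Finite := by
  rw [← Set.encard_lt_top_iff, H.regular n J hJ]
  exact ENat.natCast_lt_top r

theorem finite_level (H : TreeInFamily μ α c₁ R 𝓢₀ sel 𝒯 r) (n : ℕ) : (𝒯 n).Finite := by
  induction n with
  | zero => exact H.finite_root
  | succ n ih =>
    refine (ih.biUnion fun J hJ => H.finite_inside hJ).subset fun I hI => ?_
    obtain ⟨J, hJ, hIJ⟩ := H.parent n I hI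
    exact mem_iUnion₂.2 ⟨J, hJ, hI, hIJ⟩

/-- The parent in the tree and the parent in the construction both contain I, so by disjointness
they are the same interval; survival therefore passes up the tree. -/
theorem exists_ancestor (H : TreeInFamily μ α c₁ R 𝓢₀ sel 𝒯 r) {n m : ℕ} (hmn : m ≤ n)
    {I : Set ℝ} (hI : I ∈ 𝒯 n ∩ familyJ i j θ c R 𝓢₀ sel n) :
    ∃ J ∈ 𝒯 m ∩ familyJ i j θ c R 𝓢₀ sel m, I ⊆ J := by
  induction n, hmn using Nat.le_induction generalizing I with
  | base => exact ⟨I, hI, subset_rfl⟩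
  | succ n _ ih =>
    obtain ⟨J, hJ, hIJ⟩ := H.parent n I hI.1
    obtain ⟨⟨J', hJ', hIJ'⟩, -⟩ := hI.2
    have hJI' := familyJ_subset_familyI i j θ c R 𝓢₀ sel n hJ'
    have hs := H.choice.subset_of_mem_sel H.const_pos H.one_le H.le_one hJI' hIJ'
    have heq : J = J' := H.eq_of_subset (H.sub _ hI.1) (H.sub _ hJ) hJI' hIJ hs
    obtain ⟨K, hK, hJK⟩ := ih ⟨hJ, heq ▸ hJ'⟩
    exact ⟨K, hK, hIJ.trans hJK⟩

/-- Members of `𝒥_n` avoid the dangerous intervals of all the lower classes. -/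
theorem danger_inter_eq_empty (H : TreeInFamily μ α c₁ R 𝓢₀ sel 𝒯 r) {n m : ℕ} (hmn : m < n)
    {I : Set ℝ} (hI : I ∈ familyJ i j θ c R 𝓢₀ sel n) {A B C : ℤ}
    (hL : LineClass i j R m A B C) : danger i j θ c A B C ∩ I = ∅ := by
  induction n, hmn using Nat.le_induction generalizing I with
  | base => exact hI.2 A B C hL
  | succ n _ ih =>
    obtain ⟨⟨J, hJ, hIJ⟩, -⟩ := hI
    have hs := H.choice.subset_of_mem_sel H.const_pos H.one_le H.le_one
      (familyJ_subset_familyI i j θ c R 𝓢₀ sel n hJ) hIJ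
    exact subset_empty_iff.1 ((inter_subset_inter_right _ hs).trans (ih hJ).subset)

/-- The members of level `n + 1` of the tree that lie in a member of `𝒥_n` and are removed because
of a line of the class `C(n)`. -/
def removed (i j θ c R : ℝ) (𝓢₀ : Set (Set ℝ)) (sel : ℕ → Set ℝ → Set (Set ℝ))
    (𝒯 : ℕ → Set (Set ℝ)) (n : ℕ) : Set (Set ℝ) :=
  {I | I ∈ 𝒯 (n + 1) ∧ ∃ J ∈ 𝒯 n ∩ familyJ i j θ c R 𝓢₀ sel n, I ⊆ J ∧
    ∃ A B C : ℤ, LineClass i j R n A B C ∧ (danger i j θ c A B C ∩ I).Nonempty}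

/-- Distinct survivors have disjoint sets of r children, and each child either survives or is
removed. -/
theorem mul_ncard_le (H : TreeInFamily μ α c₁ R 𝓢₀ sel 𝒯 r) (n : ℕ) :
    r * (𝒯 n ∩ familyJ i j θ c R 𝓢₀ sel n).ncard ≤
      (𝒯 (n + 1) ∩ familyJ i j θ c R 𝓢₀ sel (n + 1)).ncard
        + (removed i j θ c R 𝓢₀ sel 𝒯 n).ncard := by
  classical
  have hfin : (𝒯 n ∩ familyJ i j θ c R 𝓢₀ sel n).Finite :=
    (H.finite_level n).subset inter_subset_left
  have hfin' : (𝒯 (n + 1) ∩ familyJ i j θ c R 𝓢₀ sel (n + 1)).Finite :=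
    (H.finite_level (n + 1)).subset inter_subset_left
  have hfinr : (removed i j θ c R 𝓢₀ sel 𝒯 n).Finite :=
    (H.finite_level (n + 1)).subset fun I hI => hI.1
  have hcard : ∀ J ∈ hfin.toFinset,
      ((H.finite_level (n + 1)).toFinset.filter fun I => I ⊆ J).card = r := by
    intro J hJ
    have hJT : J ∈ 𝒯 n := (hfin.mem_toFinset.1 hJ).1
    have h1 := H.regular n J hJT
    have h2 : inside 𝒯 (n + 1) J
        = (((H.finite_level (n + 1)).toFinset.filter fun I => I ⊆ J : Finset (Set ℝ)) :
            Set (Set ℝ)) := by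
      ext I; simp [inside]
    rw [h2, Set.encard_coe_eq_coe_finsetCard] at h1
    exact_mod_cast h1
  have hdisj : (hfin.toFinset : Set (Set ℝ)).PairwiseDisjoint fun J =>
      (H.finite_level (n + 1)).toFinset.filter fun I => I ⊆ J := by
    intro J hJ J' hJ' hne
    refine Finset.disjoint_left.2 fun I hI hI' => hne ?_
    rw [Finset.mem_filter, Set.Finite.mem_toFinset] at hI hI'
    exact H.eq_of_subset (H.sub _ hI.1) (H.sub _ (hfin.mem_toFinset.1 hJ).1)
      (H.sub _ (hfin.mem_toFinset.1 hJ').1) hI.2 hI'.2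
  have hunion := Finset.card_biUnion hdisj
  rw [Finset.sum_congr rfl hcard, Finset.sum_const, smul_eq_mul] at hunion
  rw [Set.ncard_eq_toFinset_card _ hfin, mul_comm, ← hunion, Set.ncard_eq_toFinset_card _ hfin',
    Set.ncard_eq_toFinset_card _ hfinr]
  refine (Finset.card_le_card ?_).trans (Finset.card_union_le _ _)
  intro I hI
  obtain ⟨J, hJ, hIJ⟩ := Finset.mem_biUnion.1 hI
  rw [Finset.mem_filter, Set.Finite.mem_toFinset] at hIJ
  have hJ := hfin.mem_toFinset.1 hJ
  rw [Finset.mem_union, Set.Finite.mem_toFinset, Set.Finite.mem_toFinset]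
  by_cases hrem : I ∈ removed i j θ c R 𝓢₀ sel 𝒯 n
  · exact Or.inr hrem
  · left
    refine ⟨hIJ.1, ?_, ?_⟩
    · obtain ⟨J', hJ', hIJ'⟩ := mem_iUnion₂.1 (H.sub _ hIJ.1)
      have hs := H.choice.subset_of_mem_sel H.const_pos H.one_le H.le_one hJ' hIJ'
      have heq : J = J' := H.eq_of_subset (H.sub _ hIJ.1) (H.sub _ hJ.1) hJ' hIJ.2 hs
      exact ⟨J, hJ.2, heq ▸ hIJ'⟩
    · intro A B C hL
      by_contra hne
      exact hrem ⟨hIJ.1, J, hJ, hIJ.2, A, B, C, hL, nonempty_iff_ne_empty.2 hne⟩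

end TreeInFamily

/-! ### Decomposition of the classes into blocks -/

/-- The number of dyadic scales between `1` and `R`. -/
def scaleCount (R : ℝ) : ℕ := ⌊Real.logb 2 R⌋₊ + 1

theorem exists_dyadic_scale {R x : ℝ} (hx : 1 ≤ x) (hxR : x ≤ R) :
    ∃ k < scaleCount R, (2 : ℝ) ^ k ≤ x ∧ x < 2 ^ (k + 1) := by
  obtain ⟨k, hk₁, hk₂⟩ := exists_nat_pow_near hx one_lt_two
  refine ⟨k, ?_, hk₁, hk₂⟩
  rw [scaleCount, Nat.lt_succ_iff]
  refine Nat.le_floor ?_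
  rw [Real.le_logb_iff_rpow_le one_lt_two (by linarith), Real.rpow_natCast]
  linarith

/-- The lower end of a dyadic range of heights of the class `C(n)`. -/
def blockHeight (R : ℝ) (n k : ℕ) : ℝ := R ^ ((n : ℝ) - 1) * 2 ^ k

/-- The lower end of a dyadic range of values of `B`. -/
def blockWidth (j R : ℝ) (n l u : ℕ) : ℝ := R ^ ((n * j - l) / (1 + j)) / 2 ^ (u + 1)

theorem blockWidth_rpow_le {j R : ℝ} (hj : 0 < j) (hR : 0 < R) (n l u : ℕ) :
    blockWidth j R n l u ^ (1 + j) ≤ R ^ (n * j - l : ℝ) := by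
  calc blockWidth j R n l u ^ (1 + j) ≤ (R ^ ((n * j - l) / (1 + j))) ^ (1 + j) := by
        unfold blockWidth
        gcongr
        exact div_le_self (by positivity) (one_le_pow₀ one_le_two)
    _ = R ^ (n * j - l : ℝ) := by
        rw [← Real.rpow_mul hR.le, div_mul_cancel₀ _ (by positivity)]

theorem exists_blockWidth {j R B : ℝ} {n : ℕ} (hj : 0 < j) (hj1 : j ≤ 1) (hR : 1 < R) (hB : 1 ≤ B)
    (hBn : B ^ (1 + j) ≤ R ^ (n * j : ℝ)) :
    ∃ l ≤ n, ∃ u < scaleCount R, blockWidth j R n l u < B ∧ B ≤ 2 * blockWidth j R n l u := by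
  have hR0 : 0 < R := by linarith
  have hB0 : 0 < B := by linarith
  have hBlog : R ^ Real.logb R B = B := Real.rpow_logb hR0 hR.ne' hB0
  have hlog0 : 0 ≤ Real.logb R B := Real.logb_nonneg hR hB
  obtain ⟨z, hz⟩ : ∃ z : ℝ, z = n * j - (1 + j) * Real.logb R B := ⟨_, rfl⟩
  have hz0 : 0 ≤ z := by
    rw [← hBlog, ← Real.rpow_mul hR0.le, Real.rpow_le_rpow_left_iff hR] at hBn
    linarith
  have hn0 : (0 : ℝ) ≤ n := Nat.cast_nonneg n
  have hzn : z ≤ n := by nlinarith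
  have hl₁ := Nat.floor_le hz0
  have hl₂ := Nat.lt_floor_add_one z
  refine ⟨⌊z⌋₊, Nat.floor_le_of_le hzn, ?_⟩
  -- With B^(1+j) = R^(nj-z), rounding z down overshoots B by a factor between 1 and R, which the
  -- dyadic index u then corrects.
  set l := ⌊z⌋₊
  have hquot : R ^ ((n * j - l) / (1 + j)) = B * R ^ ((z - l) / (1 + j)) := by
    calc R ^ ((n * j - l) / (1 + j)) = R ^ (Real.logb R B + (z - l) / (1 + j)) := by
          congr 1
          rw [hz]; field_simp; ring
      _ = B * R ^ ((z - l) / (1 + j)) := by rw [Real.rpow_add hR0, hBlog]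
  have hx1 : 1 ≤ R ^ ((z - l) / (1 + j)) :=
    Real.one_le_rpow hR.le (div_nonneg (by linarith) (by linarith))
  have hxR : R ^ ((z - l) / (1 + j)) ≤ R := by
    calc R ^ ((z - l) / (1 + j)) ≤ R ^ (1 : ℝ) := by
          refine Real.rpow_le_rpow_of_exponent_le hR.le ?_
          rw [div_le_one (by linarith)]
          linarith
      _ = R := Real.rpow_one R
  obtain ⟨u, hu, hu₁, hu₂⟩ := exists_dyadic_scale hx1 hxR
  refine ⟨u, hu, ?_, ?_⟩
  · rw [blockWidth, hquot, div_lt_iff₀ (by positivity)]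
    gcongr
  · rw [blockWidth, hquot, pow_succ, mul_div_assoc', le_div_iff₀ (by positivity)]
    nlinarith

theorem rpow_le_of_height_le {i j X : ℝ} (hj : 0 < j) {A B : ℤ} (hB : 0 < B)
    (hH : height i j A B ≤ X) : (B : ℝ) ^ (1 + j) ≤ X ^ j := by
  have hB0 : (0 : ℝ) < B := by exact_mod_cast hB
  have h1 : (B : ℝ) ^ (1 + 1 / j) ≤ X := by
    refine le_trans ?_ hH
    rw [Real.rpow_add hB0, Real.rpow_one, height]
    gcongr
    refine le_trans (le_of_eq ?_) (le_max_right _ _)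
    rw [abs_of_pos hB0]
  calc (B : ℝ) ^ (1 + j) = ((B : ℝ) ^ (1 + 1 / j)) ^ j := by
        rw [← Real.rpow_mul hB0.le]; congr 1; field_simp; ring
    _ ≤ X ^ j := by gcongr

theorem one_le_height (i : ℝ) {j : ℝ} (hj : 0 < j) {A B : ℤ} (hB : 0 < B) : 1 ≤ height i j A B := by
  have h1 : (1 : ℝ) ≤ B := by exact_mod_cast hB
  have h2 := one_le_weight i j hj A B hB
  unfold height
  nlinarith

/-- A point that is dangerous for a line of `C(n)`, and for no line of the lower classes, is
dangerous for a line of some block, and for no line of height below that block. -/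
theorem exists_block {i j θ c R y : ℝ} {n : ℕ} (hj : 0 < j) (hj1 : j ≤ 1) (hR : 1 < R)
    (hy : y ∈ Icc (0 : ℝ) 1)
    (hex : ∃ A B C : ℤ, LineClass i j R n A B C ∧ y ∈ danger i j θ c A B C)
    (hlow : ∀ m < n, ∀ A B C : ℤ, LineClass i j R m A B C → y ∉ danger i j θ c A B C) :
    ∃ k < scaleCount R, ∃ l ≤ n, ∃ u < scaleCount R, blockHeight R n k ≤ R ^ (n : ℝ) ∧
      ∃ L : ℤ × ℤ × ℤ, InBlock i j (blockHeight R n k) (blockWidth j R n l u) L ∧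
        |lineForm θ L y| ≤ c / weight i j L.1 L.2.1 ∧
        ∀ L' : ℤ × ℤ × ℤ, Int.gcd L'.1 (Int.gcd L'.2.1 L'.2.2) = 1 → 0 < L'.2.1 →
          height i j L'.1 L'.2.1 < blockHeight R n k →
            ¬ |lineForm θ L' y| ≤ c / weight i j L'.1 L'.2.1 := by
  classical
  have hR0 : 0 < R := by linarith
  have hzp : R ^ ((n : ℤ) - 1) = R ^ ((n : ℝ) - 1) := by
    rw [← Real.rpow_intCast]; push_cast; rfl
  have hsplit : R ^ n = R ^ ((n : ℝ) - 1) * R := by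
    rw [← Real.rpow_natCast]
    nth_rewrite 3 [← Real.rpow_one R]
    rw [← Real.rpow_add hR0]; congr 1; ring
  have hP : 0 < R ^ ((n : ℝ) - 1) := by positivity
  let P : ℕ → Prop := fun k => k < scaleCount R ∧ ∃ L : ℤ × ℤ × ℤ,
    LineClass i j R n L.1 L.2.1 L.2.2 ∧ blockHeight R n k ≤ height i j L.1 L.2.1 ∧
      height i j L.1 L.2.1 < 2 * blockHeight R n k ∧
      |lineForm θ L y| ≤ c / weight i j L.1 L.2.1
  have hscale : ∀ L : ℤ × ℤ × ℤ, LineClass i j R n L.1 L.2.1 L.2.2 →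
      |lineForm θ L y| ≤ c / weight i j L.1 L.2.1 →
      ∃ k, P k ∧ blockHeight R n k ≤ height i j L.1 L.2.1 := by
    intro L hL hLy
    have h1 : 1 ≤ height i j L.1 L.2.1 / R ^ ((n : ℝ) - 1) := by
      rw [one_le_div hP, ← hzp]; exact hL.2.2.1
    have h2 : height i j L.1 L.2.1 / R ^ ((n : ℝ) - 1) ≤ R := by
      rw [div_le_iff₀ hP, mul_comm, ← hsplit]; exact hL.2.2.2.le
    obtain ⟨k, hk, hk₁, hk₂⟩ := exists_dyadic_scale h1 h2
    rw [le_div_iff₀ hP, mul_comm] at hk₁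
    rw [div_lt_iff₀ hP, pow_succ] at hk₂
    refine ⟨k, ⟨hk, L, hL, hk₁, ?_, hLy⟩, hk₁⟩
    unfold blockHeight
    linarith
  have hPex : ∃ k, P k := by
    obtain ⟨A, B, C, hL, hLy⟩ := hex
    obtain ⟨k, hk, -⟩ := hscale (A, B, C) hL hLy.2
    exact ⟨k, hk⟩
  obtain ⟨hk, L, hL, hk₁, hk₂, hLy⟩ := Nat.find_spec hPex
  -- Taking the least dyadic range excludes lower dangerous lines within C(n); those below C(n) are
  -- excluded by `hlow`.
  have hmin : ∀ k, P k → Nat.find hPex ≤ k := fun k hPk => Nat.find_min' hPex hPk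
  generalize Nat.find hPex = k at hk hk₁ hk₂ hmin
  have hkn : blockHeight R n k ≤ R ^ (n : ℝ) := by
    rw [Real.rpow_natCast]
    exact hk₁.trans hL.2.2.2.le
  have hB1 : (1 : ℝ) ≤ L.2.1 := by exact_mod_cast hL.2.1
  have hBn : (L.2.1 : ℝ) ^ (1 + j) ≤ R ^ (n * j : ℝ) := by
    have := rpow_le_of_height_le hj hL.2.1 hL.2.2.2.le
    rwa [← Real.rpow_natCast, ← Real.rpow_mul hR0.le] at this
  obtain ⟨l, hl, u, hu, hb₁, hb₂⟩ := exists_blockWidth hj hj1 hR hB1 hBn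
  refine ⟨k, hk, l, hl, u, hu, hkn, L, ⟨hL.1, hL.2.1, hk₁, hk₂, hb₁, hb₂⟩, hLy, ?_⟩
  intro L' hg hB' hH' hL'y
  by_cases hcase : R ^ ((n : ℤ) - 1) ≤ height i j L'.1 L'.2.1
  · have hL' : LineClass i j R n L'.1 L'.2.1 L'.2.2 :=
      ⟨hg, hB', hcase, hH'.trans_le (hk₁.trans hL.2.2.2.le)⟩
    obtain ⟨k', hPk', hk'⟩ := hscale L' hL' hL'y
    have h1 := hmin k' hPk'
    have h2 : blockHeight R n k ≤ blockHeight R n k' := by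
      unfold blockHeight
      gcongr
      exact one_le_two
    linarith
  · push Not at hcase
    -- Heights in [R^m, R^(m+1)) belong to C(m+1), whence the shift; the height is at least 1, so m
    -- exists.
    obtain ⟨m, hm₁, hm₂⟩ := exists_nat_pow_near (one_le_height i hj hB' (A := L'.1)) hR
    have hmn : m + 1 < n := by
      have h1 : R ^ (m : ℤ) < R ^ ((n : ℤ) - 1) := by
        rw [zpow_natCast]; linarith
      have := (zpow_lt_zpow_iff_right₀ hR).1 h1
      omega
    refine hlow (m + 1) hmn L'.1 L'.2.1 L'.2.2 ⟨hg, hB', ?_, hm₂⟩ ⟨hy, hL'y⟩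
    push_cast
    rw [add_sub_cancel_right, zpow_natCast]
    exact hm₁

/-! ### Growth of the surviving part of the tree -/

/-- The members of level `n + 1` inside `J` that are removed because of a line of a block, but of no
line of smaller height. -/
def removedByBlock (i j θ c R h b : ℝ) (𝒯 : ℕ → Set (Set ℝ)) (n : ℕ) (J : Set ℝ) : Set (Set ℝ) :=
  {I | I ∈ 𝒯 (n + 1) ∧ I ⊆ J ∧ h ≤ R ^ (n : ℝ) ∧ ∃ y ∈ I, ∃ L : ℤ × ℤ × ℤ, InBlock i j h b L ∧
    |lineForm θ L y| ≤ c / weight i j L.1 L.2.1 ∧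
    ∀ L' : ℤ × ℤ × ℤ, Int.gcd L'.1 (Int.gcd L'.2.1 L'.2.2) = 1 → 0 < L'.2.1 →
      height i j L'.1 L'.2.1 < h → ¬ |lineForm θ L' y| ≤ c / weight i j L'.1 L'.2.1}

namespace TreeInFamily

variable {μ : Measure ℝ} {β b₁ b₂ i j θ cθ R : ℝ} {𝓢₀ : Set (Set ℝ)}
  {sel : ℕ → Set ℝ → Set (Set ℝ)} {𝒯 : ℕ → Set (Set ℝ)} {r : ℕ}

theorem ncard_removedByBlock_le
    (H : TreeInFamily μ (expAlpha β i j) (const1 β i j cθ R) R 𝓢₀ sel 𝒯 r)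
    (hpow : PowerLaw μ β b₁ b₂) (hβ1 : β ≤ 1) (hb₁₂ : b₁ ≤ b₂) (hi : 0 < i) (hj : 0 < j)
    (hij : i + j = 1) (hθ : BadWitness i θ cθ) (hR : LargeBase β i j b₁ b₂ R) {n l : ℕ} (hl : l ≤ n)
    {h b : ℝ} (hh : R ^ ((n : ℝ) - 1) ≤ h) (hb : 0 < b)
    (hbl : b ^ (1 + j) ≤ R ^ (n * j - l : ℝ)) {J : Set ℝ} (hJ : J ∈ 𝒯 (n - l)) :
    ((removedByBlock i j θ (const0 β i j cθ R) R h b 𝒯 n J).ncard : ℝ) ≤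
      99 * (b₂ / b₁) ^ 2 * R ^ ((β - 10 * expEps β i j) * (l + 1)) := by
  have hfin : (removedByBlock i j θ (const0 β i j cθ R) R h b 𝒯 n J).Finite :=
    (H.finite_level (n + 1)).subset fun I hI => hI.1
  have hR0 : 0 < R := by linarith [hR.four_le]
  have hb₁ := hpow.lower_pos
  have hb₂ := hpow.upper_pos
  rcases (removedByBlock i j θ (const0 β i j cθ R) R h b 𝒯 n J).eq_empty_or_nonempty
    with hempty | ⟨I₀, hI₀⟩
  · rw [hempty, Set.ncard_empty, Nat.cast_zero]
    positivity
  -- The bound on h is part of `removedByBlock`, so blocks above C(n) remove nothing and need no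
  -- separate treatment.
  have hhn : h ≤ R ^ (n : ℝ) := hI₀.2.2.1
  obtain ⟨y₀, -, rfl⟩ := H.choice.exists_centre (n - l) (H.sub _ hJ)
  have hdata : ∀ I : Set ℝ, ∃ (x y : ℝ) (L : ℤ × ℤ × ℤ), I ∈ hfin.toFinset →
      x ∈ μ.support ∧ I = Metric.closedBall x (levelRadius (const1 β i j cθ R) R (n + 1)) ∧
      y ∈ I ∧ InBlock i j h b L ∧
      |lineForm θ L y| ≤ const0 β i j cθ R / weight i j L.1 L.2.1 ∧
      ∀ L' : ℤ × ℤ × ℤ, Int.gcd L'.1 (Int.gcd L'.2.1 L'.2.2) = 1 → 0 < L'.2.1 →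
        height i j L'.1 L'.2.1 < h →
          ¬ |lineForm θ L' y| ≤ const0 β i j cθ R / weight i j L'.1 L'.2.1 := by
    intro I
    by_cases hI : I ∈ hfin.toFinset
    · obtain ⟨hIT, -, -, y, hy, L, hL, hLy, hlow⟩ := hfin.mem_toFinset.1 hI
      obtain ⟨x, hx, hIx⟩ := H.choice.exists_centre (n + 1) (H.sub _ hIT)
      exact ⟨x, y, L, fun _ => ⟨hx, hIx, hy, hL, hLy, hlow⟩⟩
    · exact ⟨0, 0, 0, fun h' => absurd h' hI⟩
  choose x y L hdata using hdata
  have hr := levelRadius_pos H.const_pos hR0 (n + 1)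
  have hxI : ∀ I ∈ hfin.toFinset, x I ∈ I := fun I hI =>
    (Set.ext_iff.1 (hdata I hI).2.1 (x I)).2 (Metric.mem_closedBall_self hr.le)
  have hsub : ∀ I ∈ hfin.toFinset, ∀ u ∈ I,
      |u - y₀| ≤ levelRadius (const1 β i j cθ R) R (n - l) := by
    intro I hI u hu
    rw [← Real.dist_eq, ← Metric.mem_closedBall]
    exact (hfin.mem_toFinset.1 hI).2.1 hu
  rw [Set.ncard_eq_toFinset_card _ hfin]
  refine card_le_of_level hpow hβ1 hb₁₂ hi hj hij hθ hR hl hh hhn hb hbl hfin.toFinset x y L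
    (fun I hI => (hdata I hI).1) ?_ (fun I hI => hsub I hI _ (hxI I hI))
    (fun I hI => hsub I hI _ (hdata I hI).2.2.1) ?_ (fun I hI => (hdata I hI).2.2.2.1)
    (fun I hI => (hdata I hI).2.2.2.2.1) (fun I hI => (hdata I hI).2.2.2.2.2)
  · intro I hI I' hI' hne
    by_contra hcon
    push Not at hcon
    refine hne (H.eq_of_subset (H.sub _ (hfin.mem_toFinset.1 hI).1)
      (H.sub _ (hfin.mem_toFinset.1 hI).1) (H.sub _ (hfin.mem_toFinset.1 hI').1) subset_rfl ?_)
    by_contra hnot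
    have hdisj := H.choice.disjoint_of_ne H.const_pos H.one_le H.le_one
      (H.sub _ (hfin.mem_toFinset.1 hI).1) (H.sub _ (hfin.mem_toFinset.1 hI').1) hne
    refine disjoint_left.1 hdisj (hxI I hI) ?_
    rw [(hdata I' hI').2.1, Metric.mem_closedBall, Real.dist_eq]
    exact hcon
  · intro I hI
    have := (Set.ext_iff.1 (hdata I hI).2.1 (y I)).1 (hdata I hI).2.2.1
    rw [Metric.mem_closedBall, dist_comm, Real.dist_eq] at this
    exact this

theorem ncard_removed_le
    (H : TreeInFamily μ (expAlpha β i j) (const1 β i j cθ R) R 𝓢₀ sel 𝒯 r)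
    (hpow : PowerLaw μ β b₁ b₂) (hβ1 : β ≤ 1) (hb₁₂ : b₁ ≤ b₂) (hi : 0 < i) (hj : 0 < j)
    (hij : i + j = 1) (hθ : BadWitness i θ cθ) (hR : LargeBase β i j b₁ b₂ R) (n : ℕ) :
    ((removed i j θ (const0 β i j cθ R) R 𝓢₀ sel 𝒯 n).ncard : ℝ) ≤
      ∑ l ∈ Finset.range (n + 1), (scaleCount R : ℝ) ^ 2 *
        (((𝒯 (n - l) ∩ familyJ i j θ (const0 β i j cθ R) R 𝓢₀ sel (n - l)).ncard : ℝ) *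
          (99 * (b₂ / b₁) ^ 2 * R ^ ((β - 10 * expEps β i j) * (l + 1)))) := by
  classical
  have hR0 : 0 < R := by linarith [hR.four_le]
  have hfinr : (removed i j θ (const0 β i j cθ R) R 𝓢₀ sel 𝒯 n).Finite :=
    (H.finite_level (n + 1)).subset fun I hI => hI.1
  have hfinJ : ∀ m, (𝒯 m ∩ familyJ i j θ (const0 β i j cθ R) R 𝓢₀ sel m).Finite := fun m =>
    (H.finite_level m).subset inter_subset_left
  have hfinB : ∀ h b J, (removedByBlock i j θ (const0 β i j cθ R) R h b 𝒯 n J).Finite :=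
    fun h b J => (H.finite_level (n + 1)).subset fun I hI => hI.1
  have hcover : hfinr.toFinset ⊆ (Finset.range (n + 1)).biUnion fun l =>
      (Finset.range (scaleCount R) ×ˢ Finset.range (scaleCount R)).biUnion fun q =>
        (hfinJ (n - l)).toFinset.biUnion fun J =>
          (hfinB (blockHeight R n q.1) (blockWidth j R n l q.2) J).toFinset := by
    intro I hI
    obtain ⟨hIT, J, hJ, hIJ, A, B, C, hL, y, hy, hyI⟩ := hfinr.mem_toFinset.1 hI
    obtain ⟨k, hk, l, hl, u, hu, hkn, L, hLb, hLy, hlow⟩ := exists_block hj (by linarith)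
      (by linarith [hR.four_le] : 1 < R) hy.1 ⟨A, B, C, hL, hy⟩ (fun m hm A' B' C' hL' hy' => by
        have h0 := H.danger_inter_eq_empty hm hJ.2 hL'
        exact (h0 ▸ (⟨hy', hIJ hyI⟩ : y ∈ danger i j θ (const0 β i j cθ R) A' B' C' ∩ J) :
          y ∈ (∅ : Set ℝ)))
    -- Only ancestors that survive are counted, so the bound involves f(n-l) and can be compared
    -- with f(n).
    obtain ⟨K, hK, hJK⟩ := H.exists_ancestor (Nat.sub_le n l) hJ
    simp only [Finset.mem_biUnion, Finset.mem_range, Finset.mem_product, Set.Finite.mem_toFinset]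
    exact ⟨l, by omega, (k, u), ⟨hk, hu⟩, K, hK, hIT, hIJ.trans hJK, hkn, y, hyI, L, hLb, hLy, hlow⟩
  have hheight : ∀ k, R ^ ((n : ℝ) - 1) ≤ blockHeight R n k := fun k => by
    unfold blockHeight
    exact le_mul_of_one_le_right (by positivity) (one_le_pow₀ one_le_two)
  rw [Set.ncard_eq_toFinset_card _ hfinr]
  refine (Nat.cast_le.2 ((Finset.card_le_card hcover).trans Finset.card_biUnion_le)).trans ?_
  rw [Nat.cast_sum]
  refine Finset.sum_le_sum fun l hl => ?_
  have hl' : l ≤ n := Nat.lt_succ_iff.1 (Finset.mem_range.1 hl)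
  refine (Nat.cast_le.2 Finset.card_biUnion_le).trans ?_
  rw [Nat.cast_sum]
  refine (Finset.sum_le_sum fun q _ => ?_).trans_eq (?_ : ∑ _q ∈ Finset.range (scaleCount R) ×ˢ
    Finset.range (scaleCount R),
      (((𝒯 (n - l) ∩ familyJ i j θ (const0 β i j cθ R) R 𝓢₀ sel (n - l)).ncard : ℝ) *
          (99 * (b₂ / b₁) ^ 2 * R ^ ((β - 10 * expEps β i j) * (l + 1)))) = _)
  · refine (Nat.cast_le.2 Finset.card_biUnion_le).trans ?_
    rw [Nat.cast_sum, Set.ncard_eq_toFinset_card _ (hfinJ (n - l)), ← nsmul_eq_mul]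
    refine Finset.sum_le_card_nsmul _ _ _ fun J hJ => ?_
    rw [← Set.ncard_eq_toFinset_card _ (hfinB _ _ J)]
    exact H.ncard_removedByBlock_le hpow hβ1 hb₁₂ hi hj hij hθ hR hl' (hheight q.1)
      (by unfold blockWidth; positivity) (blockWidth_rpow_le hj hR0 n l q.2)
      ((hfinJ (n - l)).mem_toFinset.1 hJ).1
  · rw [Finset.sum_const, Finset.card_product, Finset.card_range, nsmul_eq_mul]
    push_cast
    ring

end TreeInFamily

/-- The total loss at a step is small compared with the number of available children. -/
theorem sum_loss_le {β i j b₁ b₂ R : ℝ} (hR : LargeBase β i j b₁ b₂ R) (hb₁ : 0 < b₁)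
    (hb₁₂ : b₁ ≤ b₂) (f : ℕ → ℝ) (hf : ∀ m, 0 ≤ f m) (n : ℕ)
    (hgrow : ∀ m < n, R ^ (β - expEps β i j) * f m ≤ f (m + 1)) :
    ∑ l ∈ Finset.range (n + 1), (scaleCount R : ℝ) ^ 2 *
        (f (n - l) * (99 * (b₂ / b₁) ^ 2 * R ^ ((β - 10 * expEps β i j) * (l + 1))))
      ≤ 2 * R ^ (β - expEps β i j) * f n := by
  have hR0 : 0 < R := by linarith [hR.four_le]
  have h8 := hR.eight_le hb₁ hb₁₂
  have hratio := hR.ratio_le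
  have hlog := hR.logb_le
  have hlog0 : 0 ≤ Real.logb 2 R := Real.logb_nonneg one_lt_two (by linarith [hR.four_le])
  generalize expEps β i j = ε at *
  set Q := R ^ ε with hQ
  have hQ0 : 0 < Q := by positivity
  have hpow : ∀ k : ℕ, R ^ (-(k * ε)) = (Q ^ k)⁻¹ := fun k => by
    rw [Real.rpow_neg hR0.le, hQ, ← Real.rpow_natCast, ← Real.rpow_mul hR0.le, mul_comm]
  have hU : (scaleCount R : ℝ) ≤ 2 * Q := by
    unfold scaleCount
    push_cast
    linarith [Nat.floor_le hlog0]
  have hq : 64 * (b₂ / b₁) ^ 2 ≤ Q ^ 2 := by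
    rwa [mul_comm 2 ε, Real.rpow_mul hR0.le, ← hQ, Real.rpow_two] at hratio
  -- The growth already known at lower levels, iterated l times.
  have hback : ∀ l ≤ n, f (n - l) * R ^ ((β - ε) * l) ≤ f n := by
    intro l
    induction l with
    | zero => intro _; simp
    | succ l ih =>
      intro hl
      refine le_trans ?_ (ih (by omega))
      have h1 := hgrow (n - (l + 1)) (by omega)
      rw [show n - (l + 1) + 1 = n - l by omega] at h1
      have h2 : R ^ ((β - ε) * ((l + 1 : ℕ) : ℝ)) = R ^ (β - ε) * R ^ ((β - ε) * l) := by
        rw [← Real.rpow_add hR0]; congr 1; push_cast; ring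
      rw [h2]
      calc f (n - (l + 1)) * (R ^ (β - ε) * R ^ ((β - ε) * l))
          = (R ^ (β - ε) * f (n - (l + 1))) * R ^ ((β - ε) * l) := by ring
        _ ≤ _ := by gcongr
  have hterm : ∀ l ∈ Finset.range (n + 1), (scaleCount R : ℝ) ^ 2 *
        (f (n - l) * (99 * (b₂ / b₁) ^ 2 * R ^ ((β - 10 * ε) * (l + 1))))
      ≤ R ^ (β - ε) * f n * (1 / 2) ^ l := by
    intro l hl
    have hl' : l ≤ n := Nat.lt_succ_iff.1 (Finset.mem_range.1 hl)
    have h1 : R ^ ((β - 10 * ε) * (l + 1))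
        = R ^ ((β - ε) * l) * (R ^ (β - ε) * ((Q ^ 9)⁻¹ * ((Q ^ 9)⁻¹) ^ l)) := by
      rw [← hpow 9, ← Real.rpow_natCast (R ^ _), ← Real.rpow_mul hR0.le, ← Real.rpow_add hR0,
        ← Real.rpow_add hR0, ← Real.rpow_add hR0]
      congr 1; push_cast; ring
    have h9 : (Q ^ 9)⁻¹ ≤ 1 / 2 := by
      rw [inv_eq_one_div]
      refine one_div_le_one_div_of_le two_pos ?_
      calc (2 : ℝ) ≤ 8 ^ 9 := by norm_num
        _ ≤ Q ^ 9 := by gcongr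
    -- There are at most (2Q)² pairs of scales, and 99(b₂/b₁)² ≤ 2 · 64(b₂/b₁)² ≤ 2Q²; together at
    -- most 8Q⁴ ≤ Q⁵.
    have hconst : (scaleCount R : ℝ) ^ 2 * (99 * (b₂ / b₁) ^ 2) * (Q ^ 9)⁻¹ ≤ 1 := by
      rw [← div_eq_mul_inv, div_le_one (by positivity)]
      calc (scaleCount R : ℝ) ^ 2 * (99 * (b₂ / b₁) ^ 2) ≤ (2 * Q) ^ 2 * (2 * Q ^ 2) := by
            refine mul_le_mul (by gcongr) ?_ (by positivity) (by positivity)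
            linarith [sq_nonneg (b₂ / b₁)]
        _ = 8 * Q ^ 4 := by ring
        _ ≤ Q * Q ^ 4 := by gcongr
        _ = Q ^ 5 := by ring
        _ ≤ Q ^ 9 := pow_le_pow_right₀ (by linarith) (by norm_num)
    rw [h1]
    calc (scaleCount R : ℝ) ^ 2 * (f (n - l) * (99 * (b₂ / b₁) ^ 2 *
          (R ^ ((β - ε) * l) * (R ^ (β - ε) * ((Q ^ 9)⁻¹ * ((Q ^ 9)⁻¹) ^ l)))))
        = ((scaleCount R : ℝ) ^ 2 * (99 * (b₂ / b₁) ^ 2) * (Q ^ 9)⁻¹) *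
          (R ^ (β - ε) * (f (n - l) * R ^ ((β - ε) * l)) * ((Q ^ 9)⁻¹) ^ l) := by ring
      _ ≤ 1 * (R ^ (β - ε) * f n * (1 / 2) ^ l) := by
          have := hf (n - l)
          have := hf n
          gcongr
          exact hback l hl'
      _ = _ := one_mul _
  calc _ ≤ ∑ l ∈ Finset.range (n + 1), R ^ (β - ε) * f n * (1 / 2) ^ l := Finset.sum_le_sum hterm
    _ = R ^ (β - ε) * f n * ∑ l ∈ Finset.range (n + 1), (1 / 2 : ℝ) ^ l := by
        rw [Finset.mul_sum]
    _ ≤ R ^ (β - ε) * f n * 2 := by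
        have := hf n
        gcongr
        exact sum_geometric_two_le (n + 1)
    _ = _ := by ring

end VerticalCantor

end

/-! ### The induction on levels -/

theorem lemma10
    (i j : ℝ) (hi : 0 < i) (hj : 0 < j) (hij : i + j = 1)
    (θ cθ : ℝ) (hθ : VerticalCantor.BadWitness i θ cθ)
    (μ : MeasureTheory.Measure ℝ) [MeasureTheory.IsProbabilityMeasure μ]
    (hμ : μ (Set.Icc (0 : ℝ) 1)ᶜ = 0)
    (β b₁ b₂ : ℝ) (hpow : VerticalCantor.PowerLaw μ β b₁ b₂)
    (R : ℕ)
    (hR : max (VerticalCantor.threshold1 β i j b₁ b₂) (VerticalCantor.threshold2 β) ≤ (R : ℝ))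
    (𝓢₀ : Set (Set ℝ)) (sel : ℕ → Set ℝ → Set (Set ℝ))
    (hsel : VerticalCantor.IsChoice μ (VerticalCantor.expAlpha β i j)
      (VerticalCantor.const1 β i j cθ R) R 𝓢₀ sel)
    (J₀ : Set ℝ)
    (hJ₀ : J₀ ∈ VerticalCantor.familyJ i j θ (VerticalCantor.const0 β i j cθ R) R 𝓢₀ sel 0)
    (𝒯 : ℕ → Set (Set ℝ)) (htree : VerticalCantor.TreeLike 𝒯 J₀)
    (hsub : ∀ n, 𝒯 n ⊆ VerticalCantor.familyI 𝓢₀ sel n)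
    (hreg : VerticalCantor.Regular 𝒯 ⌈3 * (R : ℝ) ^ (β - VerticalCantor.expEps β i j)⌉₊)
    (n : ℕ) :
    (𝒯 n ∩ VerticalCantor.familyJ i j θ (VerticalCantor.const0 β i j cθ R) R 𝓢₀ sel n).Nonempty := by
  have hβ1 := hpow.exponent_le_one hμ
  have hb₁₂ := hpow.lower_le_upper
  have hβ := hpow.exponent_pos
  have hb₁ := hpow.lower_pos
  have hbase := VerticalCantor.LargeBase.of_threshold_le hβ hβ1 hi hj hb₁ hpow.upper_pos hR
  have hR1 : (1 : ℝ) ≤ R := by linarith [hbase.four_le]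
  have hα1 : VerticalCantor.expAlpha β i j ≤ 1 := by
    have := VerticalCantor.mul_le_quarter hij
    have h0 : 0 < i * j := by positivity
    unfold VerticalCantor.expAlpha
    nlinarith
  have H : VerticalCantor.TreeInFamily μ (VerticalCantor.expAlpha β i j)
      (VerticalCantor.const1 β i j cθ R) R 𝓢₀ sel 𝒯
      ⌈3 * (R : ℝ) ^ (β - VerticalCantor.expEps β i j)⌉₊ :=
    ⟨hsel, VerticalCantor.const1_pos hθ.1 (by linarith), hR1, hα1, htree.parent, hsub, hreg,
      htree.root ▸ Set.finite_singleton J₀⟩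
  have hR0 : (0 : ℝ) < R := by linarith
  have hgrow : ∀ m, (R : ℝ) ^ (β - VerticalCantor.expEps β i j) *
      (𝒯 m ∩ VerticalCantor.familyJ i j θ (VerticalCantor.const0 β i j cθ R) R 𝓢₀ sel m).ncard ≤
      (𝒯 (m + 1) ∩
        VerticalCantor.familyJ i j θ (VerticalCantor.const0 β i j cθ R) R 𝓢₀ sel (m + 1)).ncard := by
    intro m
    induction m using Nat.strong_induction_on with
    | _ m ih =>
      have h1 : ((_ : ℕ) : ℝ) ≤ ((_ : ℕ) : ℝ) := Nat.cast_le.2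
        (H.mul_ncard_le (i := i) (j := j) (θ := θ) (c := VerticalCantor.const0 β i j cθ R) m)
      push_cast at h1
      have h2 := (H.ncard_removed_le hpow hβ1 hb₁₂ hi hj hij hθ hbase m).trans
        (VerticalCantor.sum_loss_le hbase hb₁ hb₁₂
          (fun m => ((𝒯 m ∩ VerticalCantor.familyJ i j θ (VerticalCantor.const0 β i j cθ R) R 𝓢₀
            sel m).ncard : ℝ)) (fun m => Nat.cast_nonneg _) m ih)
      -- At least 3R^(β-ε) children per survivor, minus a loss of at most 2R^(β-ε) per survivor,
      -- leaves the required R^(β-ε).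
      have h3 := mul_le_mul_of_nonneg_right
        (Nat.le_ceil (3 * (R : ℝ) ^ (β - VerticalCantor.expEps β i j)))
        (Nat.cast_nonneg (𝒯 m ∩ VerticalCantor.familyJ i j θ (VerticalCantor.const0 β i j cθ R) R
          𝓢₀ sel m).ncard : (0 : ℝ) ≤ _)
      linarith
  have hpos : ∀ m, (0 : ℝ) < (𝒯 m ∩
      VerticalCantor.familyJ i j θ (VerticalCantor.const0 β i j cθ R) R 𝓢₀ sel m).ncard := by
    intro m
    induction m with
    | zero =>
      have : 𝒯 0 ∩ VerticalCantor.familyJ i j θ (VerticalCantor.const0 β i j cθ R) R 𝓢₀ sel 0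
          = {J₀} := by
        rw [htree.root]
        exact Set.inter_eq_left.2 (Set.singleton_subset_iff.2 hJ₀)
      rw [this, Set.ncard_singleton]
      norm_num
    | succ m ih => exact lt_of_lt_of_le (mul_pos (Real.rpow_pos_of_pos hR0 _) ih) (hgrow m)
  exact Set.nonempty_of_ncard_ne_zero (Nat.cast_pos.1 (hpos n)).ne'
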